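/- Let $\Bbbk$ be a commutative ring, $\mathcal V$ a finite set (colours of vertices, "interactions"), $\mathcal F$ a set (colours of flags, "fields", all treated as bosonic, i.e. without signs) and $\mathrm{Adm}\subseteq \mathcal F\times\mathcal F$ a set of admissible connections. **Graphs.** A coloured graph $\Gamma$ consists of finite sets of vertices $V(\Gamma)$ and flags $F(\Gamma)$, a map $\partial:F(\Gamma)\to V(\Gamma)$, an involution $\sigma$ of $F(\Gamma)$, and colourings $V(\Gamma)\to\mathcal V$, $c:F(\Gamma)\to\mathcal F$. A flag with $\sigma(f)=f$ is an external line; a pair $\{f,\sigma(f)\}$ with $f\ne\sigma(f)$ is an inner edge, called a tadpole if $\partial f=\partial\sigma(f)$. $\Gamma$ is $\mathrm{Adm}$-admissible if $(c(f),c(\sigma(f)))\in\mathrm{Adm}$ whenever $f\ne\sigma(f)$; it is 1PI if it is connected, remains connected after any one inner edge is cut into two external lines, has no tadpoles and has at least two vertices. Let $\mathrm{Dgm}(n)$ be the set of isomorphism classes of coloured graphs whose vertices are enumerated by $1,\dots,n$. For $J\subseteq V(\Gamma)$, the subgraph $\Gamma_J$ has vertices $J$ and all the flags attached to $J$ (the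 flags of edges leaving $J$ become external); for $L\in\mathcal V$, the contraction $\Gamma/(J,L)$ is obtained by replacing $J$ by a single vertex of colour $L$ and removing the flags of the inner edges of $\Gamma_J$. Both get the induced enumeration, the new vertex being placed as $\min J$. **Contraction operad.** For $n\ge1$ let $\mathcal U(n)=\mathrm{Hom}_{\Bbbk}(\Bbbk^{(\mathrm{Dgm}(n))},\Bbbk^{(\mathcal V)})$, write $Q(\Gamma)=\sum_{L}q(\Gamma,L)\,L$, let $S_n$ act through renumbering of the vertices, and for $Q''\in\mathcal U(n)$, $Q'\in\mathcal U(j)$, $1\le i\le n$ put $$(Q''\circ_iQ')(\Gamma)=\sum_{L\in\mathcal V}q'(\Gamma_J,L)\;Q''\bigl(\Gamma/(J,L)\bigr),\qquad \Gamma\in\mathrm{Dgm}(n-1+j),$$ where $J$ is the set of vertices with numbers $i,\dots,i+j-1$. Let $\mathcal T\subseteq\mathrm{Dgm}(1)$ be a set of classes of one-vertex graphs without tadpoles (types of vertices). Let $\mathcal U_{\mathrm{Adm},\mathcal T}(n)\subseteq\mathcal U(n)$ be the submodule of those $Q$ for which $q(\Gamma,L)=0$ unless $\Gamma$ is 1PI,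 $\mathrm{Adm}$-admissible and without tadpoles, $\Gamma_{\{v\}}\in\mathcal T$ for every vertex $v$ of $\Gamma$, and $\Gamma/(V(\Gamma),L)\in\mathcal T$. **Wick operator.** For $v_1,\dots,v_n\in\mathcal T$ let $\mathrm{Wick}_n(v_1,\dots,v_n)\in\Bbbk^{(\mathrm{Dgm}(n))}$ be the sum of all $\mathrm{Adm}$-admissible tadpole-free graphs obtained by connecting $v_1,\dots,v_n$, i.e. the sum over all involutions $\sigma$ of the disjoint union of the sets of flags of $v_1,\dots,v_n$ for which the resulting enumerated graph is $\mathrm{Adm}$-admissible and has no tadpoles (each involution contributes one term). For $Q\in\mathcal U(n)$ let $\widehat Q:\Bbbk^{(\mathrm{Dgm}(n))}\to\Bbbk^{(\mathrm{Dgm}(1))}$ be the linear map $\widehat Q(\Gamma)=\sum_{L}q(\Gamma,L)\,[\Gamma/(V(\Gamma),L)]$. **Proposition.** Operads here are symmetric operads of $\Bbbk$-modules in arities $n\ge1$, given by right $S_n$-actions and partial compositions $\circ_i$ satisfying the sequential, parallel and equivariance axioms; no unit is required (note that $\mathcal U_{\mathrm{Adm},\mathcal T}(1)=0$, as 1PI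 graphs have at least two vertices). The submodules $\mathcal U_{\mathrm{Adm},\mathcal T}(n)$ are stable under the actions and the compositions $\circ_i$ and form a symmetric operad, and so do the modules $\mathrm{End}_E(n)=\mathrm{Hom}(E^{\otimes n},E)$ for the free $\Bbbk$-module $E=\Bbbk^{(\mathcal T)}$ on $\mathcal T$. There are unique linear maps $$R_n:\mathcal U_{\mathrm{Adm},\mathcal T}(n)\to\mathrm{End}_{E}(n),\qquad R_n(Q)(v_1\otimes\cdots\otimes v_n)=\widehat Q\bigl(\mathrm{Wick}_n(v_1,\dots,v_n)\bigr)\quad(v_1,\dots,v_n\in\mathcal T),$$ (in particular the right-hand side lies in $\Bbbk^{(\mathcal T)}\subseteq\Bbbk^{(\mathrm{Dgm}(1))}$), and they form a morphism of operads: they are $S_n$-equivariant and satisfy $R_{n-1+j}(Q''\circ_iQ')=R_n(Q'')\circ_iR_j(Q')$ for all $n,j\ge1$, $1\le i\le n$. -/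

import Mathlib

/-! Coloured Feynman graphs, the universal contraction operad, its sub-operad attached to a set of
admissible connections and a set of types of vertices, endomorphism operads, and the Wick operator.
All enumerations start from `0`. -/

noncomputable section

open scoped Classical

universe u v w x

/-! ### Coloured graphs -/

/-- A coloured graph with vertex set `V`, with vertex colours in `VC` and flag colours in `FC`.
`att` attaches a flag to its vertex and the involution `inv` joins flags: a flag fixed by `inv` is an
external line, a pair of different flags `f`, `inv f` is an inner edge.  Taking `V = Fin n` gives the
enumerated coloured graphs with `n` vertices. -/
structure FGraph (VC : Type u) (FC : Type v) (V : Type) where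
  Flag : Type
  finite_flag : Finite Flag
  att : Flag → V
  inv : Flag → Flag
  inv_inv : ∀ f, inv (inv f) = f
  vcol : V → VC
  fcol : Flag → FC

namespace FGraph

variable {VC : Type u} {FC : Type v} {V W : Type}

/-- Isomorphism of coloured graphs inducing the identity on the vertices; for `V = Fin n` these are
the isomorphisms of enumerated coloured graphs. -/
def Iso (G H : FGraph VC FC V) : Prop :=
  ∃ e : G.Flag ≃ H.Flag,
    (∀ f, H.att (e f) = G.att f) ∧ (∀ f, H.inv (e f) = e (G.inv f)) ∧
    H.vcol = G.vcol ∧ (∀ f, H.fcol (e f) = G.fcol f)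

instance isoSetoid (VC : Type u) (FC : Type v) (V : Type) : Setoid (FGraph VC FC V) where
  r := Iso
  iseqv :=
    { refl := fun G => ⟨Equiv.refl _, fun _ => rfl, fun _ => rfl, rfl, fun _ => rfl⟩
      symm := by
        rintro G H ⟨e, h1, h2, h3, h4⟩
        refine ⟨e.symm, fun f => ?_, fun f => ?_, h3.symm, fun f => ?_⟩
        · rw [← h1, e.apply_symm_apply]
        · apply e.injective
          rw [← h2, e.apply_symm_apply, e.apply_symm_apply]
        · rw [← h4, e.apply_symm_apply]
      trans := by
        rintro G H K ⟨e, h1, h2, h3, h4⟩ ⟨e', h1', h2', h3', h4'⟩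
        refine ⟨e.trans e', fun f => ?_, fun f => ?_, h3'.trans h3, fun f => ?_⟩
        · simp [h1, h1']
        · simp [h2, h2']
        · simp [h4, h4'] }

/-- There is no inner edge with both ends at the same vertex. -/
def NoTadpole (G : FGraph VC FC V) : Prop :=
  ∀ f, G.inv f ≠ f → G.att (G.inv f) ≠ G.att f

/-- Every inner edge joins an admissible pair of colours. -/
def Admissible (Adm : Set (FC × FC)) (G : FGraph VC FC V) : Prop :=
  ∀ f, G.inv f ≠ f → (G.fcol f, G.fcol (G.inv f)) ∈ Adm

/-- The graph of adjacent vertices, used to express connectedness. -/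
def adjacency (G : FGraph VC FC V) : SimpleGraph V :=
  SimpleGraph.fromRel fun a b => ∃ f, G.att f = a ∧ G.att (G.inv f) = b

def Connected (G : FGraph VC FC V) : Prop := G.adjacency.Connected

/-- Cut the inner edge `{f, inv f}` into two external lines. -/
def cut (G : FGraph VC FC V) (f : G.Flag) : FGraph VC FC V where
  Flag := G.Flag
  finite_flag := G.finite_flag
  att := G.att
  inv := fun g => if g = f ∨ g = G.inv f then g else G.inv g
  inv_inv := by
    intro g
    by_cases h : g = f ∨ g = G.inv f
    · simp [h]
    · have h' : ¬ (G.inv g = f ∨ G.inv g = G.inv f) := by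
        rintro (h1 | h1)
        · exact h (Or.inr (by rw [← h1, G.inv_inv]))
        · exact h (Or.inl (by rw [← G.inv_inv g, h1, G.inv_inv]))
      simp only [h, if_false, h', G.inv_inv]
  vcol := G.vcol
  fcol := G.fcol

/-- One particle irreducible: connected, still connected after cutting any inner edge, without
tadpoles, and with at least two vertices. -/
def OnePI (G : FGraph VC FC V) : Prop :=
  G.Connected ∧ (∀ f, G.inv f ≠ f → (G.cut f).Connected) ∧ G.NoTadpole ∧ 2 ≤ Nat.card V

/-- Transport of a graph along a bijection of vertex sets. -/
def relabel (G : FGraph VC FC V) (e : V ≃ W) : FGraph VC FC W where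
  Flag := G.Flag
  finite_flag := G.finite_flag
  att := fun f => e (G.att f)
  inv := G.inv
  inv_inv := G.inv_inv
  vcol := fun b => G.vcol (e.symm b)
  fcol := G.fcol

/-- The subgraph on a set `J` of vertices: it keeps all flags attached to `J`; the flags of the edges
with only one end in `J` become external lines. -/
def sub (G : FGraph VC FC V) (J : Set V) : FGraph VC FC J where
  Flag := {f : G.Flag // G.att f ∈ J}
  finite_flag := by
    have := G.finite_flag
    infer_instance
  att := fun f => ⟨G.att f.1, f.2⟩
  inv := fun f => if h : G.att (G.inv f.1) ∈ J then ⟨G.inv f.1, h⟩ else f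
  inv_inv := by
    rintro ⟨f, hf⟩
    by_cases h : G.att (G.inv f) ∈ J
    · simp [h, G.inv_inv, hf]
    · simp [h]
  vcol := fun a => G.vcol a.1
  fcol := fun f => G.fcol f.1

/-- The contracted graph `G / (J, L)`: the vertices in `J` are shrunk to one new vertex `none`, which
gets the colour `L`, and the flags of the inner edges of the subgraph on `J` are removed. -/
def contract (G : FGraph VC FC V) (J : Set V) (L : VC) : FGraph VC FC (Option (Jᶜ : Set V)) where
  Flag := {f : G.Flag // G.att f ∈ J ∧ G.att (G.inv f) ∈ J → G.inv f = f}
  finite_flag := by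
    have := G.finite_flag
    infer_instance
  att := fun f => if h : G.att f.1 ∈ J then none else some ⟨G.att f.1, h⟩
  inv := fun f => ⟨G.inv f.1, fun h => by
    rw [G.inv_inv] at h ⊢
    exact (f.2 ⟨h.2, h.1⟩).symm⟩
  inv_inv := fun f => Subtype.ext (G.inv_inv f.1)
  vcol := fun a => a.elim L fun b => G.vcol b.1
  fcol := fun f => G.fcol f.1

theorem relabel_congr {G H : FGraph VC FC V} (h : G ≈ H) (e : V ≃ W) :
    G.relabel e ≈ H.relabel e := by
  obtain ⟨j, h1, h2, h3, h4⟩ := h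
  exact ⟨j, fun f => congrArg e (h1 f), h2, funext fun b => congrFun h3 _, h4⟩

theorem sub_inv_val (G : FGraph VC FC V) (J : Set V) (f : (G.sub J).Flag) :
    ((G.sub J).inv f).1 = if G.att (G.inv f.1) ∈ J then G.inv f.1 else f.1 := by
  change (if h : G.att (G.inv f.1) ∈ J then
    (⟨G.inv f.1, h⟩ : {f : G.Flag // G.att f ∈ J}) else f).1 = _
  by_cases h : G.att (G.inv f.1) ∈ J
  · exact (congrArg Subtype.val (dif_pos h)).trans (if_pos h).symm
  · exact (congrArg Subtype.val (dif_neg h)).trans (if_neg h).symm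

theorem sub_congr {G H : FGraph VC FC V} (h : G ≈ H) (J : Set V) : G.sub J ≈ H.sub J := by
  obtain ⟨j, h1, h2, h3, h4⟩ := h
  let e : (G.sub J).Flag ≃ (H.sub J).Flag := j.subtypeEquiv fun f => by rw [h1]
  have he : ∀ f, (e f).1 = j f.1 := fun _ => rfl
  refine ⟨e, fun f => Subtype.ext (h1 f.1), fun f => ?_, funext fun b => congrFun h3 _,
    fun f => h4 f.1⟩
  apply Subtype.ext
  rw [sub_inv_val, he, he, sub_inv_val, h2, h1]
  split_ifs <;> rfl

theorem contract_congr {G H : FGraph VC FC V} (h : G ≈ H) (J : Set V) (L : VC) :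
    G.contract J L ≈ H.contract J L := by
  obtain ⟨j, h1, h2, h3, h4⟩ := h
  let e : (G.contract J L).Flag ≃ (H.contract J L).Flag := j.subtypeEquiv fun f => by
    rw [h2, h1, h1, j.apply_eq_iff_eq]
  refine ⟨e, fun f => ?_, fun f => Subtype.ext (h2 f.1), ?_, fun f => h4 f.1⟩
  · change (if h : H.att (j f.1) ∈ J then none else some ⟨H.att (j f.1), h⟩ : Option (Jᶜ : Set V)) =
      if h : G.att f.1 ∈ J then none else some ⟨G.att f.1, h⟩
    simp only [h1]
  · funext b
    simp [contract, h3]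

end FGraph

/-- Isomorphism classes of enumerated coloured graphs with `n` vertices. -/
def Dgm (VC : Type u) (FC : Type v) (n : ℕ) : Type (max 1 u v) :=
  Quotient (FGraph.isoSetoid VC FC (Fin n))

namespace Dgm

variable {VC : Type u} {FC : Type v} {n : ℕ}

def mk (G : FGraph VC FC (Fin n)) : Dgm VC FC n := Quotient.mk _ G

/-- Renumbering of the vertices: the vertex with number `a` gets the number `s a`. -/
def relabel (s : Equiv.Perm (Fin n)) : Dgm VC FC n → Dgm VC FC n :=
  Quotient.map (fun G => G.relabel s) fun _ _ h => FGraph.relabel_congr h s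

/-- The one-vertex subgraph at the vertex `a`. -/
def vertexAt (a : Fin n) : Dgm VC FC n → Dgm VC FC 1 :=
  Quotient.map (fun G => (G.sub {a}).relabel (Equiv.ofUnique _ _))
    fun _ _ h => FGraph.relabel_congr (FGraph.sub_congr h _) _

/-- The only bijection from the vertex set of a completely contracted graph to `Fin 1`. -/
def pointEquiv (n : ℕ) : Option ((Set.univ : Set (Fin n))ᶜ : Set (Fin n)) ≃ Fin 1 where
  toFun := fun _ => 0
  invFun := fun _ => none
  left_inv := by
    rintro (_ | ⟨a, ha⟩)
    · rfl
    · exact absurd (Set.mem_univ a) ha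
  right_inv := fun _ => Subsingleton.elim _ _

/-- The contraction of all the vertices to a single vertex of colour `L`. -/
def contractAll (L : VC) : Dgm VC FC n → Dgm VC FC 1 :=
  Quotient.map (fun G => (G.contract Set.univ L).relabel (pointEquiv n))
    fun _ _ h => FGraph.relabel_congr (FGraph.contract_congr h _ _) _

end Dgm

/-! ### Blocks of consecutive numbers

Here `n + j = N + 1`, and the `i`-th of `n` positions is replaced by a block of `j` consecutive
positions, which leaves `N = n - 1 + j` positions. -/

namespace Block

/-- The block `{i, …, i + j - 1}`. -/
def set {n : ℕ} (j N : ℕ) (i : Fin n) : Set (Fin N) := {a | i.1 ≤ a.1 ∧ a.1 < i.1 + j}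

/-- The increasing enumeration of the block. -/
def incl {n j N : ℕ} (h : n + j = N + 1) (i : Fin n) (b : Fin j) : Fin N :=
  ⟨i.1 + b.1, by omega⟩

/-- The increasing map that sends the block to `i` and is injective outside the block. -/
def collapse {n j N : ℕ} (h : n + j = N + 1) (i : Fin n) (a : Fin N) : Fin n :=
  ⟨if a.1 < i.1 then a.1 else if a.1 < i.1 + j then i.1 else a.1 + 1 - j, by
    split_ifs <;> omega⟩

/-- The increasing bijection from the block to `Fin j`. -/
def subEquiv {n j N : ℕ} (h : n + j = N + 1) (i : Fin n) : set j N i ≃ Fin j where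
  toFun := fun a => ⟨a.1.1 - i.1, by have := a.2; simp only [set, Set.mem_ofPred_eq] at this; omega⟩
  invFun := fun b => ⟨incl h i b, by simp only [set, incl, Set.mem_ofPred_eq]; omega⟩
  left_inv := by
    rintro ⟨a, ha⟩
    simp only [set, Set.mem_ofPred_eq] at ha
    apply Subtype.ext
    apply Fin.ext
    simp only [incl]
    omega
  right_inv := by
    intro b
    apply Fin.ext
    simp only [incl]
    omega

/-- The enumeration of the vertices of a graph in which the block is contracted: the new vertex is
enumerated as if it were the minimum of the block. -/
def contractEquiv {n j N : ℕ} (h : n + j = N + 1) (i : Fin n) :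
    Option ((set j N i)ᶜ : Set (Fin N)) ≃ Fin n where
  toFun := fun a => a.elim i fun b => collapse h i b.1
  invFun := fun b =>
    if h1 : b.1 < i.1 then
      some ⟨⟨b.1, by omega⟩, by simp only [set, Set.mem_compl_iff, Set.mem_ofPred_eq]; omega⟩
    else if h2 : b.1 = i.1 then none
    else some ⟨⟨b.1 + j - 1, by omega⟩, by
      simp only [set, Set.mem_compl_iff, Set.mem_ofPred_eq]; omega⟩
  left_inv := by
    rintro (_ | ⟨a, ha⟩)
    · simp
    · simp only [set, Set.mem_compl_iff, Set.mem_ofPred_eq] at ha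
      by_cases h1 : a.1 < i.1
      · simp [collapse, h1]
      · have h2 : ¬ a.1 < i.1 + j := by omega
        have h3 : ¬ a.1 + 1 - j < i.1 := by omega
        have h4 : ¬ a.1 + 1 - j = i.1 := by omega
        simp only [Option.elim, collapse, h1, if_false, h2, h3, h4, dite_false]
        congr 2
        apply Fin.ext
        show a.1 + 1 - j + j - 1 = a.1
        omega
  right_inv := by
    intro b
    apply Fin.ext
    by_cases h1 : b.1 < i.1
    · simp [h1, collapse]
    · by_cases h2 : b.1 = i.1
      · simp [h2]
      · have h3 : ¬ b.1 + j - 1 < i.1 := by omega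
        have h4 : ¬ b.1 + j - 1 < i.1 + j := by omega
        simp only [h1, h2, dite_false, Option.elim, collapse, h3, h4, if_false]
        omega

end Block

namespace Dgm

variable {VC : Type u} {FC : Type v} {n j N : ℕ}

/-- The enumerated subgraph on the `i`-th block. -/
def blockSub (h : n + j = N + 1) (i : Fin n) : Dgm VC FC N → Dgm VC FC j :=
  Quotient.map (fun G => (G.sub (Block.set j N i)).relabel (Block.subEquiv h i))
    fun _ _ e => FGraph.relabel_congr (FGraph.sub_congr e _) _

/-- The enumerated graph obtained by contracting the `i`-th block to a vertex of colour `L`. -/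
def blockContract (h : n + j = N + 1) (i : Fin n) (L : VC) : Dgm VC FC N → Dgm VC FC n :=
  Quotient.map (fun G => (G.contract (Block.set j N i) L).relabel (Block.contractEquiv h i))
    fun _ _ e => FGraph.relabel_congr (FGraph.contract_congr e _ _) _

end Dgm

/-! ### Symmetric operads (partial compositions, no unit required) -/

/-- The operations of a symmetric operad of `k`-modules in positive arities: right actions of the
symmetric groups and partial compositions `∘ᵢ`. -/
structure OperadOps (k : Type w) [CommRing k] where
  obj : ℕ+ → Type x
  [addCommGroup : ∀ n, AddCommGroup (obj n)]
  [module : ∀ n, Module k (obj n)]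
  act : ∀ {n : ℕ+}, Equiv.Perm (Fin n) → obj n →ₗ[k] obj n
  comp : ∀ {n j N : ℕ+}, (n : ℕ) + j = N + 1 → Fin n → obj n →ₗ[k] obj j →ₗ[k] obj N

attribute [instance] OperadOps.addCommGroup OperadOps.module

namespace OperadOps

variable {k : Type w} [CommRing k]

/-- The axioms of a symmetric operad, in terms of partial compositions. -/
structure IsSymmOperad (P : OperadOps.{w, x} k) : Prop where
  act_one : ∀ {n : ℕ+} (p : P.obj n), P.act 1 p = p
  act_mul : ∀ {n : ℕ+} (s t : Equiv.Perm (Fin n)) (p : P.obj n),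
    P.act (s * t) p = P.act t (P.act s p)
  /-- Sequential composition. -/
  comp_seq : ∀ {n j m A B C : ℕ+} (hA : (n : ℕ) + j = A + 1) (hB : (j : ℕ) + m = B + 1)
    (hC : (A : ℕ) + m = C + 1) (hC2 : (n : ℕ) + B = C + 1)
    (i : Fin n) (l : Fin j) (a : Fin A) (_ : a.1 = i.1 + l.1)
    (p : P.obj n) (q : P.obj j) (r : P.obj m),
    P.comp hC a (P.comp hA i p q) r = P.comp hC2 i p (P.comp hB l q r)
  /-- Parallel composition at two positions `i < l`. -/
  comp_par : ∀ {n j m A B C : ℕ+} (hA : (n : ℕ) + j = A + 1) (hB : (n : ℕ) + m = B + 1)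
    (hC : (A : ℕ) + m = C + 1) (hC2 : (B : ℕ) + j = C + 1)
    (i l : Fin n) (_ : i < l) (a : Fin A) (_ : a.1 + 1 = l.1 + j) (b : Fin B) (_ : b.1 = i.1)
    (p : P.obj n) (q : P.obj j) (r : P.obj m),
    P.comp hC a (P.comp hA i p q) r = P.comp hC2 b (P.comp hB l p r) q
  /-- Equivariance; `ρ` is the permutation that acts by `s` on the blocks and by `t` inside the
  `i`-th block, and the two conditions determine it. -/
  comp_act : ∀ {n j N : ℕ+} (h : (n : ℕ) + j = N + 1) (i : Fin n)
    (s : Equiv.Perm (Fin n)) (t : Equiv.Perm (Fin j)) (ρ : Equiv.Perm (Fin N)),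
    (∀ a, Block.collapse h (s i) (ρ a) = s (Block.collapse h i a)) →
    (∀ b, ρ (Block.incl h i b) = Block.incl h (s i) (t b)) →
    ∀ (p : P.obj n) (q : P.obj j),
      P.comp h i (P.act s p) (P.act t q) = P.act ρ (P.comp h (s i) p q)

/-- A morphism of symmetric operads: linear maps that are equivariant and compatible with all
partial compositions. -/
structure IsMorphism (P : OperadOps.{w, x} k) {Q : OperadOps k}
    (R : ∀ n : ℕ+, P.obj n →ₗ[k] Q.obj n) : Prop where
  map_act : ∀ {n : ℕ+} (s : Equiv.Perm (Fin n)) (p : P.obj n), R n (P.act s p) = Q.act s (R n p)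
  map_comp : ∀ {n j N : ℕ+} (h : (n : ℕ) + j = N + 1) (i : Fin n) (p : P.obj n) (q : P.obj j),
    R N (P.comp h i p q) = Q.comp h i (R n p) (R j q)

/-- A family of submodules stable under all the operations. -/
structure IsStable (P : OperadOps.{w, x} k) (S : ∀ n : ℕ+, Submodule k (P.obj n)) : Prop where
  act_mem : ∀ {n : ℕ+} (s : Equiv.Perm (Fin n)) (p : P.obj n), p ∈ S n → P.act s p ∈ S n
  comp_mem : ∀ {n j N : ℕ+} (h : (n : ℕ) + j = N + 1) (i : Fin n) (p : P.obj n) (q : P.obj j),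
    p ∈ S n → q ∈ S j → P.comp h i p q ∈ S N

/-- The operations induced on a stable family of submodules. -/
def restrict (P : OperadOps.{w, x} k) (S : ∀ n : ℕ+, Submodule k (P.obj n)) (hS : P.IsStable S) :
    OperadOps.{w, x} k where
  obj := fun n => S n
  act := fun s => (P.act s).restrict fun p hp => hS.act_mem s p hp
  comp := fun h i => LinearMap.mk₂ k
    (fun p q => ⟨P.comp h i p.1 q.1, hS.comp_mem h i p.1 q.1 p.2 q.2⟩)
    (fun _ _ _ => Subtype.ext (by simp)) (fun _ _ _ => Subtype.ext (by simp))
    (fun _ _ _ => Subtype.ext (by simp)) (fun _ _ _ => Subtype.ext (by simp))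

end OperadOps

/-! ### Endomorphism operads -/

section EndOperad

variable {E : Type x}

/-- The arguments of the outer map in a partial composition `f ∘ᵢ g`: the value `y` of the inner map
at position `i`, and the arguments outside the `i`-th block, in their order, elsewhere. -/
def outerArgs {n j N : ℕ} (h : n + j = N + 1) (i : Fin n) (z : Fin N → E) (y : E) : Fin n → E :=
  fun b => ((Block.contractEquiv h i).symm b).elim y fun a => z a.1

theorem outerArgs_eq_update [AddCommGroup E] {n j N : ℕ} (h : n + j = N + 1) (i : Fin n) (z : Fin N → E) (y : E) :
    outerArgs h i z y = Function.update (outerArgs h i z 0) i y := by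
  funext b
  by_cases hb : b = i
  · subst hb
    have : (Block.contractEquiv h b).symm b = none := by
      rw [Equiv.symm_apply_eq]; rfl
    simp [outerArgs, this]
  · rw [Function.update_of_ne hb]
    unfold outerArgs
    rcases hc : (Block.contractEquiv h i).symm b with _ | a
    · rw [Equiv.symm_apply_eq] at hc
      exact absurd hc hb
    · rfl

theorem outerArgs_update_mem {n j N : ℕ} (h : n + j = N + 1) (i : Fin n) (z : Fin N → E)
    (a : Fin N) (ha : a ∈ Block.set j N i) (t y : E) :
    outerArgs h i (Function.update z a t) y = outerArgs h i z y := by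
  funext b
  unfold outerArgs
  rcases (Block.contractEquiv h i).symm b with _ | c
  · rfl
  · have : c.1 ≠ a := fun e => c.2 (e ▸ ha)
    simp [Function.update_of_ne this]

theorem outerArgs_update_not_mem {n j N : ℕ} (h : n + j = N + 1) (i : Fin n) (z : Fin N → E)
    (a : Fin N) (ha : a ∉ Block.set j N i) (t y : E) :
    outerArgs h i (Function.update z a t) y =
      Function.update (outerArgs h i z y) (Block.contractEquiv h i (some ⟨a, ha⟩)) t := by
  funext b
  by_cases hb : b = Block.contractEquiv h i (some ⟨a, ha⟩)
  · subst hb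
    simp [outerArgs]
  · rw [Function.update_of_ne hb]
    unfold outerArgs
    rcases hc : (Block.contractEquiv h i).symm b with _ | c
    · rfl
    · have : c.1 ≠ a := by
        rintro rfl
        exact hb (by rw [← hc, Equiv.apply_symm_apply])
      simp [Function.update_of_ne this]

theorem innerArgs_update_mem {n j N : ℕ} (h : n + j = N + 1) (i : Fin n) (z : Fin N → E)
    (a : Fin N) (ha : a ∈ Block.set j N i) (t : E) :
    (fun b => Function.update z a t (Block.incl h i b)) =
      Function.update (fun b => z (Block.incl h i b)) (Block.subEquiv h i ⟨a, ha⟩) t := by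
  funext b
  by_cases hb : b = Block.subEquiv h i ⟨a, ha⟩
  · have : Block.incl h i b = a := by
      subst hb
      exact congrArg Subtype.val ((Block.subEquiv h i).symm_apply_apply ⟨a, ha⟩)
    rw [this, hb]
    simp
  · have : Block.incl h i b ≠ a := by
      intro e
      apply hb
      rw [← Equiv.symm_apply_eq]
      exact Subtype.ext e
    rw [Function.update_of_ne this, Function.update_of_ne hb]

theorem innerArgs_update_not_mem {n j N : ℕ} (h : n + j = N + 1) (i : Fin n) (z : Fin N → E)
    (a : Fin N) (ha : a ∉ Block.set j N i) (t : E) :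
    (fun b => Function.update z a t (Block.incl h i b)) = fun b => z (Block.incl h i b) := by
  funext b
  have : Block.incl h i b ≠ a := by
    rintro rfl
    exact ha ((Block.subEquiv h i).symm b).2
  rw [Function.update_of_ne this]

end EndOperad

section EndOperad

variable {k : Type w} [CommRing k] {E : Type x} [AddCommGroup E] [Module k E]

/-- `(f ∘ᵢ g)(z) = f (z₀, …, g (zᵢ, …, z_{i+j-1}), …, z_{N-1})`. -/
def endComp {n j N : ℕ} (h : n + j = N + 1) (i : Fin n)
    (f : MultilinearMap k (fun _ : Fin n => E) E) (g : MultilinearMap k (fun _ : Fin j => E) E) :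
    MultilinearMap k (fun _ : Fin N => E) E where
  toFun := fun z => f (outerArgs h i z (g fun b => z (Block.incl h i b)))
  map_update_add' := by
    intro inst z a s t
    obtain rfl : inst = instDecidableEqFin N := Subsingleton.elim _ _
    by_cases ha : a ∈ Block.set j N i
    · simp only [outerArgs_update_mem h i z a ha, innerArgs_update_mem h i z a ha]
      rw [g.map_update_add, outerArgs_eq_update, f.map_update_add, ← outerArgs_eq_update,
        ← outerArgs_eq_update]
    · simp only [outerArgs_update_not_mem h i z a ha, innerArgs_update_not_mem h i z a ha]
      rw [f.map_update_add]
  map_update_smul' := by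
    intro inst z a c t
    obtain rfl : inst = instDecidableEqFin N := Subsingleton.elim _ _
    by_cases ha : a ∈ Block.set j N i
    · simp only [outerArgs_update_mem h i z a ha, innerArgs_update_mem h i z a ha]
      rw [g.map_update_smul, outerArgs_eq_update, f.map_update_smul, ← outerArgs_eq_update]
    · simp only [outerArgs_update_not_mem h i z a ha, innerArgs_update_not_mem h i z a ha]
      rw [f.map_update_smul]

variable (k E) in
/-- The endomorphism operad of the module `E`: multilinear maps, with the right action
`(f^s)(z₀, …) = f (z_{s⁻¹(0)}, …)` and the partial compositions. -/
def endOps : OperadOps k where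
  obj := fun n => MultilinearMap k (fun _ : Fin n => E) E
  act := fun s =>
    { toFun := fun f => f.domDomCongr s.symm
      map_add' := fun _ _ => rfl
      map_smul' := fun _ _ => rfl }
  comp := fun h i => LinearMap.mk₂ k (fun f g => endComp h i f g)
    (fun _ _ _ => rfl) (fun _ _ _ => rfl)
    (fun f g g' => MultilinearMap.ext fun z => by
      show f _ = f _ + f _
      rw [add_apply, outerArgs_eq_update, f.map_update_add, ← outerArgs_eq_update,
        ← outerArgs_eq_update])
    (fun c f g => MultilinearMap.ext fun z => by
      show f _ = c • f _
      rw [smul_apply, outerArgs_eq_update, f.map_update_smul,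
        ← outerArgs_eq_update])

end EndOperad

/-! ### The contraction operad -/

section Contraction

variable (k : Type w) [CommRing k] (VC : Type u) [Fintype VC] (FC : Type v)

/-- Contraction maps of arity `n`, written through their matrix elements:
`Q(Γ) = ∑ L, Q Γ L • L`. -/
abbrev ContractionMap (n : ℕ) : Type (max 1 u v w) := Dgm VC FC n → VC → k

/-- The universal contraction operad: `S_n` acts through renumbering of the vertices, and
`(Q'' ∘ᵢ Q')(Γ) = ∑ L, q'(Γ_J, L) • Q''(Γ / (J, L))`, where `J` is the `i`-th block of vertices. -/
def contractionOps : OperadOps k where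
  obj := fun n => ContractionMap k VC FC n
  act := fun s =>
    { toFun := fun Q d K => Q (d.relabel s) K
      map_add' := fun _ _ => rfl
      map_smul' := fun _ _ => rfl }
  comp := fun h i => LinearMap.mk₂ k
    (fun Q R d K => ∑ L : VC, R (d.blockSub h i) L * Q (d.blockContract h i L) K)
    (fun _ _ _ => by funext d K; simp [mul_add, Finset.sum_add_distrib])
    (fun _ _ _ => by funext d K; simp [Finset.mul_sum, mul_left_comm])
    (fun _ _ _ => by funext d K; simp [add_mul, Finset.sum_add_distrib])
    (fun _ _ _ => by funext d K; simp [Finset.mul_sum, mul_assoc])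

variable {VC FC}

/-- The contraction maps whose matrix elements vanish outside `Φ`. -/
def supportedOn {n : ℕ} (Φ : Set (Dgm VC FC n × VC)) : Submodule k (ContractionMap k VC FC n) where
  carrier := {Q | ∀ d L, (d, L) ∉ Φ → Q d L = 0}
  add_mem' := by
    intro Q R hQ hR d L h
    simp [hQ d L h, hR d L h]
  zero_mem' := fun _ _ _ => rfl
  smul_mem' := by
    intro c Q hQ d L h
    simp [hQ d L h]

variable (VC FC) in
/-- Contraction maps vanishing on all graphs that are not one particle irreducible. -/
def onePISub (n : ℕ) : Submodule k (ContractionMap k VC FC n) :=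
  supportedOn k {x | ∃ G, Dgm.mk G = x.1 ∧ G.OnePI}

variable (VC) in
/-- Contraction maps vanishing on all graphs that are not admissible or have tadpoles. -/
def admSub (Adm : Set (FC × FC)) (n : ℕ) : Submodule k (ContractionMap k VC FC n) :=
  supportedOn k {x | ∃ G, Dgm.mk G = x.1 ∧ G.Admissible Adm ∧ G.NoTadpole}

/-- Contraction maps vanishing at all `(Γ, L)` except those for which all the vertices of `Γ`, and
the vertex `Γ / (vert Γ, L)`, are of one of the types in `T`. -/
def typeSub (T : Set (Dgm VC FC 1)) (n : ℕ) : Submodule k (ContractionMap k VC FC n) :=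
  supportedOn k {x | (∀ a, x.1.vertexAt a ∈ T) ∧ x.1.contractAll x.2 ∈ T}

/-- The arity `n` component of the contraction operad of the theory given by `Adm` and `T`. -/
def theorySub (Adm : Set (FC × FC)) (T : Set (Dgm VC FC 1)) (n : ℕ) :
    Submodule k (ContractionMap k VC FC n) :=
  onePISub k VC FC n ⊓ admSub k VC Adm n ⊓ typeSub k T n

/-! ### Wick operator and total contraction -/

/-- The enumerated graph with vertices `G 0, …, G (n-1)` whose flags are joined by `σ`. -/
def connect {n : ℕ} (G : Fin n → FGraph VC FC (Fin 1))
    (σ : {σ : (Σ a, (G a).Flag) → (Σ a, (G a).Flag) // ∀ f, σ (σ f) = f}) :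
    FGraph VC FC (Fin n) where
  Flag := Σ a, (G a).Flag
  finite_flag := by
    have := fun a => (G a).finite_flag
    infer_instance
  att := Sigma.fst
  inv := σ.1
  inv_inv := σ.2
  vcol := fun a => (G a).vcol 0
  fcol := fun f => (G f.1).fcol f.2

instance connect_fintype {n : ℕ} (G : Fin n → FGraph VC FC (Fin 1)) :
    Fintype {σ : (Σ a, (G a).Flag) → (Σ a, (G a).Flag) // ∀ f, σ (σ f) = f} :=
  have := fun a => (G a).finite_flag
  Fintype.ofFinite _

/-- The sum of all the ways to connect the vertices `G 0, …, G (n-1)` into an admissible graph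
without tadpoles.  All flags are distinguishable: every joining of flags contributes one term. -/
def wick (Adm : Set (FC × FC)) {n : ℕ} (G : Fin n → FGraph VC FC (Fin 1)) : Dgm VC FC n →₀ k :=
  ∑ σ with (connect G σ).Admissible Adm ∧ (connect G σ).NoTadpole,
    Finsupp.single (Dgm.mk (connect G σ)) 1

variable {k} in
/-- The linear extension of `Γ ↦ ∑ L, q(Γ, L) • [Γ / (vert Γ, L)]`. -/
def hatMap {n : ℕ} (Q : ContractionMap k VC FC n) : (Dgm VC FC n →₀ k) →ₗ[k] (Dgm VC FC 1 →₀ k) :=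
  Finsupp.linearCombination k fun d => ∑ L : VC, Finsupp.single (d.contractAll L) (Q d L)

/-- The linear maps `R n` are given on the basis by `R_n(Q)(v₁ ⊗ ⋯ ⊗ vₙ) = Q̂ (Wick (v₁, …, vₙ))`,
where `G` is any family of graphs representing `v₁, …, vₙ`, and where the free module on `T` is
viewed inside the free module on all the one-vertex graphs. -/
def IsWickContraction (Adm : Set (FC × FC)) (T : Set (Dgm VC FC 1))
    (R : ∀ n : ℕ+, theorySub k Adm T n →ₗ[k] MultilinearMap k (fun _ : Fin n => T →₀ k) (T →₀ k)) :
    Prop :=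
  ∀ (n : ℕ+) (Q : theorySub k Adm T n) (v : Fin n → T) (G : Fin n → FGraph VC FC (Fin 1)),
    (∀ a, Dgm.mk (G a) = v a) →
      Finsupp.mapDomain Subtype.val (R n Q fun a => Finsupp.single (v a) 1) =
        hatMap Q.1 (wick k Adm G)

end Contraction

end

noncomputable section

open scoped Classical

universe u v w x

/-! ### Minors: subgraphs, contractions and their iterations -/

/-! The partial compositions are built from two operations on an enumerated graph: passing to the
subgraph on a block of vertices, and contracting that block. The proof rests on three facts about
them.

Operad axioms. Renumberings, subgraphs, contractions and all their iterations are minors, described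
by a partial map of vertices and the colours of the vertices created by contraction. These data
decide which flags survive, how they are joined and which colours occur, so a minor is determined up
to isomorphism by its vertex map (`Minor.iso`), and minors compose (`Minor.comp`). An identity
between iterated operations thus becomes an identity of maps between finite sets of numbers, settled
by arithmetic (`iso₂₁`, `iso₂₂`). The axioms follow by interchanging sums over colours.

Stability. An inner edge of `Γ` survives as an inner edge in exactly one of `Γ_J` and `Γ/(J, L)`
(`edge_cases`), so admissibility and absence of tadpoles lift to `Γ`. A property of vertices that
spreads along edges is constant on the block because `Γ_J` is connected, hence descends to `Γ/(J,
L)` and is constant there too (`ConnOff.glue`). Cutting one edge of `Γ` cuts only one of the two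
pieces, so 1PI lifts as well.

Morphism. The core is `wickSum_block`: to join all flags is first to join the flags inside the block
by some `τ`, and then to join the flags left free by `τ` with those outside the block. The second
step is a joining of the flags of fewer vertices, one of them the contraction of the joined block.
Its condition of having no tadpole at the new vertex says exactly that no two flags of the block are
joined later, which makes the decomposition unique. Summation gives compatibility with compositions
on basis vectors; existence and uniqueness of `R` hold because the module on `T` is free, and the
type condition keeps the values inside it. -/

/-- A partial map of vertex sets, together with the colours `c` of the vertices of the target that
arise by contraction.  It is bijective over the vertices that do not arise by contraction. -/
structure VertexMap (VC : Type u) (V W : Type) where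
  p : V → Option W
  c : W → Option VC
  inj : ∀ v v' a, p v = some a → p v' = some a → c a = none → v = v'
  surj : ∀ a, c a = none → ∃ v, p v = some a

namespace FGraph

variable {VC : Type u} {FC : Type v} {V W X : Type}

/-- `H` arises from `G` by deleting the vertices at which `φ.p` is undefined, and by contracting
the fibres over the vertices that `φ.c` colours. -/
structure Minor (φ : VertexMap VC V W) (G : FGraph VC FC V) (H : FGraph VC FC W) where
  e : H.Flag → G.Flag
  inj : Function.Injective e
  att : ∀ f, φ.p (G.att (e f)) = some (H.att f)
  inv : ∀ f, e (H.inv f) = if φ.p (G.att (G.inv (e f))) = none then e f else G.inv (e f)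
  -- A flag over `a` is lost only if it belongs to an inner edge with both ends over `a`, and `a` is
  -- a contracted vertex. Over an uncoloured `a` every flag is kept, even those of a tadpole.
  range : ∀ g a, φ.p (G.att g) = some a →
    ((∃ f, e f = g) ↔ (G.inv g ≠ g → φ.p (G.att (G.inv g)) = some a → φ.c a = none))
  fcol : ∀ f, H.fcol f = G.fcol (e f)
  vcol_new : ∀ a L, φ.c a = some L → H.vcol a = L
  vcol_old : ∀ v a, φ.p v = some a → φ.c a = none → H.vcol a = G.vcol v

namespace Minor

variable {G : FGraph VC FC V} {H H' : FGraph VC FC W} {K : FGraph VC FC X}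
  {φ : VertexMap VC V W}

/-- The criterion `range` for survival of a flag mentions only `φ` and `G`, so two minors with the
same vertex map keep the same flags of `G`. -/
theorem exists_of_exists (m : Minor φ G H) (m' : Minor φ G H') (f : H.Flag) :
    ∃ f', m'.e f' = m.e f :=
  (m'.range _ _ (m.att f)).2 ((m.range _ _ (m.att f)).1 ⟨f, rfl⟩)

/-- A minor is determined by its vertex map. -/
theorem iso (m : Minor φ G H) (m' : Minor φ G H') : H ≈ H' := by
  choose t ht using m.exists_of_exists m'
  choose s hs using m'.exists_of_exists m
  refine ⟨⟨t, s, fun f => m.inj ((hs _).trans (ht _)), fun f => m'.inj ((ht _).trans (hs _))⟩,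
    fun f => ?_, fun f => ?_, ?_, fun f => ?_⟩
  · have h := m'.att (t f)
    rw [ht, m.att] at h
    exact (Option.some_injective _ h).symm
  · apply m'.inj
    change m'.e (H'.inv (t f)) = m'.e (t (H.inv f))
    rw [m'.inv, ht, ht, m.inv]
  · funext a
    rcases hc : φ.c a with _ | L
    · obtain ⟨v, hv⟩ := φ.surj a hc
      rw [m.vcol_old v a hv hc, m'.vcol_old v a hv hc]
    · rw [m.vcol_new a L hc, m'.vcol_new a L hc]
  · change H'.fcol (t f) = _
    rw [m'.fcol, ht, m.fcol]

/-- The target of a minor may be replaced by an isomorphic graph. -/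
theorem of_iso (m : Minor φ G H) (h : H ≈ H') : Nonempty (Minor φ G H') := by
  obtain ⟨j, h1, h2, h3, h4⟩ := h
  refine ⟨⟨fun f => m.e (j.symm f), m.inj.comp j.symm.injective, fun f => ?_, fun f => ?_,
    fun g a hg => ?_, fun f => ?_, fun a L h => ?_, fun v a h h' => ?_⟩⟩
  · rw [m.att, ← h1, j.apply_symm_apply]
  · rw [← m.inv]
    congr 1
    rw [Equiv.symm_apply_eq, ← h2, j.apply_symm_apply]
  · rw [← m.range g a hg]
    constructor
    · rintro ⟨f, hf⟩
      exact ⟨_, hf⟩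
    · rintro ⟨f, hf⟩
      exact ⟨j f, by simpa using hf⟩
  · rw [← m.fcol, ← h4, j.apply_symm_apply]
  · rw [h3, m.vcol_new a L h]
  · rw [h3, m.vcol_old v a h h']

/-- The colour part of the composition of two vertex maps. -/
def IsColourComp (c₁ : W → Option VC) (φ₂ : VertexMap VC W X) (c : X → Option VC) : Prop :=
  (∀ a b, φ₂.p a = some b → φ₂.c b = none → c b = c₁ a) ∧ ∀ b L, φ₂.c b = some L → c b = some L

/-- The composition of vertex maps. -/
def _root_.VertexMap.comp (φ₁ : VertexMap VC V W) (φ₂ : VertexMap VC W X) (c : X → Option VC)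
    (hc : IsColourComp φ₁.c φ₂ c) : VertexMap VC V X where
  p := fun v => (φ₁.p v).bind φ₂.p
  c := c
  inj := by
    intro v v' b h h' hb
    have h2 : φ₂.c b = none := by
      rcases h0 : φ₂.c b with _ | L
      · rfl
      · simp [hc.2 b L h0] at hb
    obtain ⟨a, ha, hab⟩ := Option.bind_eq_some_iff.1 h
    obtain ⟨a', ha', hab'⟩ := Option.bind_eq_some_iff.1 h'
    obtain rfl := φ₂.inj a a' b hab hab' h2
    exact φ₁.inj v v' a ha ha' (by rw [← hc.1 a b hab h2, hb])
  surj := by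
    intro b hb
    have h2 : φ₂.c b = none := by
      rcases h0 : φ₂.c b with _ | L
      · rfl
      · simp [hc.2 b L h0] at hb
    obtain ⟨a, ha⟩ := φ₂.surj b h2
    obtain ⟨v, hv⟩ := φ₁.surj a (by rw [← hc.1 a b ha h2, hb])
    exact ⟨v, by simp [hv, ha]⟩

/-- A minor of a minor is a minor. -/
def comp {φ₂ : VertexMap VC W X} (m : Minor φ G H) (m₂ : Minor φ₂ H K) (c : X → Option VC)
    (hc : IsColourComp φ.c φ₂ c) : Minor (φ.comp φ₂ c hc) G K where
  e := fun f => m.e (m₂.e f)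
  inj := m.inj.comp m₂.inj
  att := by
    intro f
    simp [VertexMap.comp, m.att, m₂.att]
  inv := by
    intro f
    have hi := m.inv (m₂.e f)
    have ha := m.att (H.inv (m₂.e f))
    rw [m₂.inv]
    have hp : (φ.comp φ₂ c hc).p (G.att (G.inv (m.e (m₂.e f)))) =
      (φ.p (G.att (G.inv (m.e (m₂.e f))))).bind φ₂.p := rfl
    by_cases h : φ.p (G.att (G.inv (m.e (m₂.e f)))) = none
    · rw [if_pos h] at hi
      rw [m.inj hi, ite_self, if_pos (by rw [hp, h, Option.bind_none])]
    · rw [if_neg h] at hi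
      rw [hi] at ha
      have hb := hp
      rw [ha, Option.bind_some] at hb
      by_cases h1 : φ₂.p (H.att (H.inv (m₂.e f))) = none
      · rw [if_pos h1, if_pos (hb.trans h1)]
      · rw [if_neg h1, if_neg (fun h2 => h1 (hb.symm.trans h2)), hi]
  range := by
    intro g b hg
    obtain ⟨a, ha, hab⟩ := Option.bind_eq_some_iff.1 hg
    have key : φ₂.c b = none → c b = φ.c a := hc.1 a b hab
    have key' : c b = none → φ₂.c b = none := by
      intro hb
      rcases h0 : φ₂.c b with _ | L
      · rfl
      · simp [hc.2 b L h0] at hb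
    simp only [VertexMap.comp]
    constructor
    -- An edge that survives twice and has both ends over `b`: survival in the second step makes `b`
    -- uncoloured by `φ₂`, so injectivity puts both ends over the same `a`, and survival in the
    -- first step then gives the colour of `a`.
    · rintro ⟨f, rfl⟩ hne hb
      have hr := (m.range _ a ha).1 ⟨_, rfl⟩
      obtain ⟨a', ha', hab'⟩ := Option.bind_eq_some_iff.1 hb
      have hi := m.inv (m₂.e f)
      rw [if_neg (by simp [ha'])] at hi
      have hat := m.att (H.inv (m₂.e f))
      rw [hi, ha'] at hat
      have hat' := Option.some_injective _ hat
      have hat₀ := m.att (m₂.e f)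
      rw [ha] at hat₀
      have h2 := (m₂.range (m₂.e f) b (by rw [← Option.some_injective _ hat₀, hab])).1
        ⟨f, rfl⟩ (by intro h; apply hne; rw [← hi, h]) (by rw [← hat', hab'])
      obtain rfl := φ₂.inj a a' b hab hab' h2
      rw [key h2]
      exact hr hne ha'
    -- Conversely the flag is lifted twice: the hypothesis on `b` implies the survival criterion
    -- over `a`, and then the criterion for the second minor.
    · intro h
      obtain ⟨g, rfl⟩ := (m.range g a ha).2 (by
        intro hne h'
        have h0 := h hne (by simp [h', hab])
        rw [← key (key' h0), h0])
      have hat := m.att g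
      rw [ha] at hat
      obtain rfl := Option.some_injective _ hat
      obtain ⟨f, rfl⟩ := (m₂.range g b hab).2 (by
        intro hne h'
        have hi := m.inv g
        split_ifs at hi with h0
        · exact absurd (m.inj hi) hne
        · have hat' := m.att (H.inv g)
          rw [hi] at hat'
          refine key' (h (fun h1 => hne (m.inj (hi.trans h1))) ?_)
          simp [hat', h'])
      exact ⟨f, rfl⟩
  fcol := fun f => by rw [m₂.fcol, m.fcol]
  vcol_new := by
    intro b L hb
    change c b = some L at hb
    rcases h0 : φ₂.c b with _ | L'
    · obtain ⟨a, ha⟩ := φ₂.surj b h0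
      rw [m₂.vcol_old a b ha h0]
      exact m.vcol_new a L (by rw [← hc.1 a b ha h0, hb])
    · rw [m₂.vcol_new b L' h0]
      have := hc.2 b L' h0
      rw [hb] at this
      exact (Option.some_injective _ this).symm
  vcol_old := by
    intro v b hv hb
    change c b = none at hb
    have h2 : φ₂.c b = none := by
      rcases h0 : φ₂.c b with _ | L
      · rfl
      · simp [hc.2 b L h0] at hb
    obtain ⟨a, ha, hab⟩ := Option.bind_eq_some_iff.1 hv
    rw [m₂.vcol_old a b hab h2, m.vcol_old v a ha (by rw [← hc.1 a b hab h2, hb])]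

/-- Transport of a minor along an equality of vertex maps. -/
theorem iso_of_eq {φ' : VertexMap VC V W} (m : Minor φ G H) (m' : Minor φ' G H')
    (hp : ∀ v, φ.p v = φ'.p v) (hc : ∀ a, φ.c a = φ'.c a) : H ≈ H' := by
  obtain rfl : φ = φ' := by
    obtain ⟨p, c, _, _⟩ := φ
    obtain ⟨p', c', _, _⟩ := φ'
    obtain rfl : p = p' := funext hp
    obtain rfl : c = c' := funext hc
    rfl
  exact m.iso m'

/-- Comparison of a minor of a minor with a minor. -/
theorem iso₂₁ {φ₂ : VertexMap VC W X} {ψ : VertexMap VC V X} {K' : FGraph VC FC X}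
    (m : Minor φ G H) (m₂ : Minor φ₂ H K) (m' : Minor ψ G K')
    (hp : ∀ v, (φ.p v).bind φ₂.p = ψ.p v) (hc : IsColourComp φ.c φ₂ ψ.c) : K ≈ K' :=
  (m.comp m₂ _ hc).iso_of_eq m' hp fun _ => rfl

/-- Comparison of two minors of minors. -/
theorem iso₂₂ {W' : Type} {H' : FGraph VC FC W'} {φ₂ : VertexMap VC W X}
    {ψ : VertexMap VC V W'} {ψ₂ : VertexMap VC W' X} {K' : FGraph VC FC X}
    (m : Minor φ G H) (m₂ : Minor φ₂ H K) (m' : Minor ψ G H') (m₂' : Minor ψ₂ H' K')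
    (hp : ∀ v, (φ.p v).bind φ₂.p = (ψ.p v).bind ψ₂.p) (c : X → Option VC)
    (hc : IsColourComp φ.c φ₂ c) (hc' : IsColourComp ψ.c ψ₂ c) : K ≈ K' :=
  (m.comp m₂ c hc).iso_of_eq (m'.comp m₂' c hc') hp fun _ => rfl

end Minor

end FGraph

/-! ### Vertex maps of the elementary operations -/

namespace VertexMap

variable (VC : Type u) {V W : Type} {n j N : ℕ}

/-- The vertex map of a renumbering. -/
def ofEquiv (s : V ≃ W) : VertexMap VC V W where
  p := fun v => some (s v)
  c := fun _ => none
  inj := fun v v' a h h' _ => s.injective (Option.some_injective _ (h.trans h'.symm))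
  surj := fun a _ => ⟨s.symm a, by simp⟩

/-- The vertex map of the subgraph on a block. -/
def blockSub (h : n + j = N + 1) (i : Fin n) : VertexMap VC (Fin N) (Fin j) where
  p := fun v => if h : i.1 ≤ v.1 ∧ v.1 < i.1 + j then some ⟨v.1 - i.1, by omega⟩ else none
  c := fun _ => none
  inj := by
    intro v v' a
    split_ifs
    · simp only [Option.some.injEq, Fin.ext_iff]
      omega
    all_goals simp
  surj := fun a _ => ⟨Block.incl h i a, by simp [Block.incl]⟩

variable {VC} in
/-- The vertex map of the contraction of a block. -/
def blockContract (h : n + j = N + 1) (i : Fin n) (L : VC) : VertexMap VC (Fin N) (Fin n) where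
  p := fun v => some (Block.collapse h i v)
  c := fun a => if a = i then some L else none
  inj := by
    intro v v' a
    simp only [Block.collapse, Option.some.injEq, Fin.ext_iff]
    intro h1 h2 h3
    split_ifs at h1 h2 h3 <;> omega
  surj := by
    intro a ha
    have h1 : a.1 ≠ i.1 := by
      intro h
      simp [Fin.ext h] at ha
    rcases lt_or_gt_of_ne h1 with h2 | h2
    · refine ⟨⟨a.1, by omega⟩, ?_⟩
      simp [Block.collapse, h2]
    -- Contracting a block of length `j` to one position moves the vertices to its right down by `j
    -- - 1`.
    · refine ⟨⟨a.1 + j - 1, by omega⟩, ?_⟩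
      have h3 : ¬ a.1 + j - 1 < i.1 := by omega
      have h4 : ¬ a.1 + j - 1 < i.1 + j := by omega
      simp only [Block.collapse, h3, h4, if_false, Option.some.injEq, Fin.ext_iff]
      omega

/-- The vertex map of the one-vertex subgraph at `a`. -/
def vertexAt (a : Fin n) : VertexMap VC (Fin n) (Fin 1) where
  p := fun v => if v = a then some 0 else none
  c := fun _ => none
  inj := by
    intro v v' b
    split_ifs <;> simp_all
  surj := fun b _ => ⟨a, by simp; exact Subsingleton.elim _ _⟩

variable {VC} in
/-- The vertex map of the contraction of all vertices. -/
def contractAll (n : ℕ) (L : VC) : VertexMap VC (Fin n) (Fin 1) where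
  p := fun _ => some 0
  c := fun _ => some L
  inj := by simp
  surj := by simp

end VertexMap

/-! ### Renumberings, subgraphs and contractions as minors -/

namespace FGraph

variable {VC : Type u} {FC : Type v} {V W : Type} {n j N : ℕ}

def relabelMinor (G : FGraph VC FC V) (s : V ≃ W) :
    Minor (VertexMap.ofEquiv VC s) G (G.relabel s) where
  e := id
  inj := Function.injective_id
  att := fun _ => rfl
  inv := fun _ => rfl
  range := fun g _ _ => ⟨fun _ _ _ => rfl, fun _ => ⟨g, rfl⟩⟩
  fcol := fun _ => rfl
  vcol_new := by simp [VertexMap.ofEquiv]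
  vcol_old := by
    rintro v a h -
    obtain rfl := Option.some_injective _ h
    simp [relabel]

/-- The renumbered subgraph on `J` is a minor. -/
def subMinor (G : FGraph VC FC V) (J : Set V) (s : J ≃ W) (φ : VertexMap VC V W)
    (hp : ∀ v, φ.p v = if h : v ∈ J then some (s ⟨v, h⟩) else none) (hc : ∀ a, φ.c a = none) :
    Minor φ G ((G.sub J).relabel s) where
  e := Subtype.val
  inj := Subtype.val_injective
  att := fun f => by
    rw [hp, dif_pos f.2]
    rfl
  inv := fun f => by
    refine (sub_inv_val G J f).trans ?_
    rw [hp]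
    by_cases h : G.att (G.inv f.1) ∈ J <;> simp [h]
  range := by
    intro g a h
    rw [hp] at h
    split_ifs at h with h1
    exact ⟨fun _ _ _ => hc a, fun _ => ⟨⟨g, h1⟩, rfl⟩⟩
  fcol := fun _ => rfl
  vcol_new := by simp [hc]
  vcol_old := by
    intro v a h _
    rw [hp] at h
    split_ifs at h with h1
    obtain rfl := Option.some_injective _ h
    simp [relabel, sub]

/-- The renumbered contraction of `J` is a minor. -/
def contractMinor (G : FGraph VC FC V) (J : Set V) (L : VC) (s : Option (Jᶜ : Set V) ≃ W)
    (φ : VertexMap VC V W)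
    (hp : ∀ v, φ.p v = some (s (if h : v ∈ J then none else some ⟨v, h⟩)))
    (hc : ∀ a, φ.c a = if a = s none then some L else none) :
    Minor φ G ((G.contract J L).relabel s) where
  e := Subtype.val
  inj := Subtype.val_injective
  att := fun f => by
    rw [hp]
    rfl
  inv := fun f => by
    rw [if_neg (by simp [hp])]
    rfl
  range := by
    intro g a h
    rw [hp] at h
    obtain rfl := Option.some_injective _ h
    rw [hp, hc]
    -- Only the vertex `s none` is coloured. A surviving edge with both ends over it would lie
    -- inside `J` and have been removed; over any other vertex nothing is removed.
    constructor
    · rintro ⟨f, rfl⟩ h1 h2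
      have := f.2
      by_cases h3 : G.att f.1 ∈ J
      · by_cases h4 : G.att (G.inv f.1) ∈ J
        · exact absurd (this ⟨h3, h4⟩) h1
        · simp [h3, h4] at h2
      · simp [h3]
    · intro h1
      refine ⟨⟨g, fun h => ?_⟩, rfl⟩
      by_contra h2
      simpa [h.1] using h1 h2 (by simp [h])
  fcol := fun _ => rfl
  vcol_new := by
    intro a L' h
    rw [hc] at h
    split_ifs at h with h1
    subst h1
    obtain rfl := Option.some_injective _ h
    simp [relabel, contract]
  vcol_old := by
    intro v a h h'
    rw [hp] at h
    obtain rfl := Option.some_injective _ h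
    rw [hc] at h'
    by_cases h1 : v ∈ J
    · simp [h1] at h'
    · simp [h1, relabel, contract]

def blockSubMinor (G : FGraph VC FC (Fin N)) (h : n + j = N + 1) (i : Fin n) :
    Minor (VertexMap.blockSub VC h i) G
      ((G.sub (Block.set j N i)).relabel (Block.subEquiv h i)) :=
  G.subMinor _ _ _ 
    (fun v => by
      by_cases hv : v ∈ Block.set j N i
      · rw [dif_pos hv]
        exact dif_pos hv
      · rw [dif_neg hv]
        exact dif_neg hv)
    fun _ => rfl

def blockContractMinor (G : FGraph VC FC (Fin N)) (h : n + j = N + 1) (i : Fin n) (L : VC) :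
    Minor (VertexMap.blockContract h i L) G
      ((G.contract (Block.set j N i) L).relabel (Block.contractEquiv h i)) :=
  G.contractMinor _ _ _ _
    (fun v => by
      by_cases hv : v ∈ Block.set j N i
      · rw [dif_pos hv]
        have h1 : i.1 ≤ v.1 ∧ v.1 < i.1 + j := hv
        have h2 : ¬ v.1 < i.1 := by omega
        simp [VertexMap.blockContract, Block.collapse, Block.contractEquiv, h1, h2]
      · rw [dif_neg hv]
        rfl)
    fun a => by simp [VertexMap.blockContract, Block.contractEquiv]

def vertexAtMinor (G : FGraph VC FC (Fin n)) (a : Fin n) :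
    Minor (VertexMap.vertexAt VC a) G ((G.sub {a}).relabel (Equiv.ofUnique _ _)) :=
  G.subMinor _ _ _
    (fun v => by
      by_cases hv : v = a <;> simp [VertexMap.vertexAt, hv])
    fun _ => rfl

def contractAllMinor (G : FGraph VC FC (Fin n)) (L : VC) :
    Minor (VertexMap.contractAll n L) G
      ((G.contract Set.univ L).relabel (Dgm.pointEquiv n)) :=
  G.contractMinor _ _ _ _ (fun v => by simp [VertexMap.contractAll, Dgm.pointEquiv])
    fun a => by
      obtain rfl : a = 0 := Subsingleton.elim _ _
      simp [VertexMap.contractAll, Dgm.pointEquiv]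

end FGraph

/-! ### Iterated subgraphs and contractions -/

section Block

variable {n j N : ℕ} (h : n + j = N + 1) (i : Fin n)

theorem Block.collapse_eq_iff (_hj : 0 < j) (v : Fin N) :
    Block.collapse h i v = i ↔ i.1 ≤ v.1 ∧ v.1 < i.1 + j := by
  simp only [Block.collapse, Fin.ext_iff]
  split_ifs <;> omega

theorem Block.exists_incl (v : Fin N) (hv : i.1 ≤ v.1 ∧ v.1 < i.1 + j) :
    ∃ b, Block.incl h i b = v :=
  ⟨⟨v.1 - i.1, by omega⟩, Fin.ext (by simp only [Block.incl]; omega)⟩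

theorem VertexMap.blockSub_incl (VC : Type u) (b : Fin j) :
    (VertexMap.blockSub VC h i).p (Block.incl h i b) = some b := by
  simp [VertexMap.blockSub, Block.incl]

theorem VertexMap.blockSub_eq_some (VC : Type u) (v : Fin N) (b : Fin j) :
    (VertexMap.blockSub VC h i).p v = some b ↔ v.1 = i.1 + b.1 := by
  simp only [VertexMap.blockSub]
  split_ifs <;> simp [Fin.ext_iff] <;> omega

end Block

namespace Dgm

open FGraph

variable {VC : Type u} {FC : Type v} {n j m A B C N : ℕ}

theorem relabel_one (d : Dgm VC FC n) : d.relabel 1 = d := by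
  induction d using Quotient.inductionOn with
  | h G => exact Quotient.sound (Setoid.refl _)

theorem relabel_mul (s t : Equiv.Perm (Fin n)) (d : Dgm VC FC n) :
    d.relabel (s * t) = (d.relabel t).relabel s := by
  induction d using Quotient.inductionOn with
  | h G => exact Quotient.sound (Setoid.refl _)

/-- Subgraph of a subgraph. -/
theorem blockSub_blockSub (hB : j + m = B + 1)
    (hC : A + m = C + 1) (hC2 : n + B = C + 1) (i : Fin n) (l : Fin j) (a : Fin A)
    (ha : a.1 = i.1 + l.1) (d : Dgm VC FC C) :
    (d.blockSub hC2 i).blockSub hB l = d.blockSub hC a := by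
  induction d using Quotient.inductionOn with
  | h G =>
    refine Quotient.sound (Minor.iso₂₁ (G.blockSubMinor hC2 i) (blockSubMinor _ hB l)
      (G.blockSubMinor hC a) (fun v => ?_) ⟨fun _ _ _ _ => rfl, fun _ _ h => h⟩)
    simp only [VertexMap.blockSub]
    split_ifs <;> simp [Fin.ext_iff] <;> omega

/-- Contraction inside a subgraph. -/
theorem blockSub_blockContract (hA : n + j = A + 1) (hB : j + m = B + 1)
    (hC : A + m = C + 1) (hC2 : n + B = C + 1) (i : Fin n) (l : Fin j) (a : Fin A)
    (ha : a.1 = i.1 + l.1) (L : VC) (d : Dgm VC FC C) :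
    (d.blockContract hC a L).blockSub hA i = (d.blockSub hC2 i).blockContract hB l L := by
  induction d using Quotient.inductionOn with
  | h G =>
    refine Quotient.sound (Minor.iso₂₂ (G.blockContractMinor hC a L) (blockSubMinor _ hA i)
      (G.blockSubMinor hC2 i) (blockContractMinor _ hB l L) (fun v => ?_)
      -- The final colours, common to both orders: only the vertex `l` of the subgraph arises by
      -- contraction, and it is the vertex `a = i + l` of the graph contracted first.
      (fun x => if x = l then some L else none) ⟨fun x y h _ => ?_, by simp [VertexMap.blockSub]⟩
      ⟨fun x y h h' => h', fun x L h => h⟩)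
    · have := l.2
      ext w
      rw [show (VertexMap.blockContract hC a L).p v = some (Block.collapse hC a v) from rfl,
        Option.bind_some, VertexMap.blockSub_eq_some]
      by_cases hv : i.1 ≤ v.1 ∧ v.1 < i.1 + B
      · obtain ⟨b, rfl⟩ := Block.exists_incl hC2 i v hv
        rw [VertexMap.blockSub_incl, Option.bind_some,
          show (VertexMap.blockContract hB l L).p b = some (Block.collapse hB l b) from rfl]
        have : (Block.collapse hC a (Block.incl hC2 i b)).1 = i.1 + (Block.collapse hB l b).1 := by
          simp only [Block.collapse, Block.incl]
          grind
        rw [this, Option.some.injEq, Fin.ext_iff]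
        omega
      · have := w.2
        rw [show (VertexMap.blockSub VC hC2 i).p v = none from dif_neg hv]
        simp only [Block.collapse, Option.bind_none, reduceCtorEq, iff_false]
        split_ifs <;> omega
    · simp only [VertexMap.blockSub] at h
      split_ifs at h with h1
      simp only [Option.some.injEq, Fin.ext_iff] at h
      simp only [VertexMap.blockContract, Fin.ext_iff]
      congr 1
      apply propext
      omega

/-- Contraction of a block that contains the result of a contraction. -/
theorem blockContract_blockContract (hA : n + j = A + 1) (hB : j + m = B + 1)
    (hC : A + m = C + 1) (hC2 : n + B = C + 1) (i : Fin n) (l : Fin j) (a : Fin A)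
    (ha : a.1 = i.1 + l.1) (L M : VC) (d : Dgm VC FC C) :
    (d.blockContract hC a L).blockContract hA i M = d.blockContract hC2 i M := by
  induction d using Quotient.inductionOn with
  | h G =>
    refine Quotient.sound (Minor.iso₂₁ (G.blockContractMinor hC a L) (blockContractMinor _ hA i M)
      (G.blockContractMinor hC2 i M) (fun v => ?_) ⟨fun x y h h' => ?_, fun x L h => h⟩)
    · have := l.2
      have := v.2
      simp only [VertexMap.blockContract, Block.collapse, Option.bind_some, Option.some.injEq,
        Fin.ext_iff]
      split_ifs <;> omega
    · have := l.2
      simp only [VertexMap.blockContract, Block.collapse, Option.some.injEq, Fin.ext_iff] at h h' ⊢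
      split_ifs at h h' ⊢ <;> first | rfl | omega

/-- The subgraph on a block after contraction of a block to the right of it. -/
theorem blockSub_blockContract_right (hA : n + j = A + 1) (hB : n + m = B + 1)
    (hC : A + m = C + 1) (hC2 : B + j = C + 1) (i l : Fin n) (hil : i < l) (a : Fin A)
    (ha : a.1 + 1 = l.1 + j) (b : Fin B) (hb : b.1 = i.1) (L : VC) (d : Dgm VC FC C) :
    (d.blockContract hC a L).blockSub hA i = d.blockSub hC2 b := by
  induction d using Quotient.inductionOn with
  | h G =>
    have hil' : i.1 < l.1 := hil
    refine Quotient.sound (Minor.iso₂₁ (G.blockContractMinor hC a L) (blockSubMinor _ hA i)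
      (G.blockSubMinor hC2 b) (fun v => ?_) ⟨fun x y h _ => ?_, fun x L h => h⟩)
    · have := v.2
      simp only [VertexMap.blockSub, VertexMap.blockContract, Block.collapse]
      split_ifs <;> (try simp) <;> (try split_ifs) <;> (try simp [Fin.ext_iff]) <;> omega
    · simp only [VertexMap.blockSub] at h
      split_ifs at h with h1
      refine (if_neg ?_).symm
      rintro rfl
      omega

/-- The subgraph on a block after contraction of a block to the left of it. -/
theorem blockSub_blockContract_left (hA : n + j = A + 1) (hB : n + m = B + 1)
    (hC : A + m = C + 1) (hC2 : B + j = C + 1) (i l : Fin n) (hil : i < l) (a : Fin A)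
    (ha : a.1 + 1 = l.1 + j) (b : Fin B) (hb : b.1 = i.1) (M : VC) (d : Dgm VC FC C) :
    (d.blockContract hC2 b M).blockSub hB l = d.blockSub hC a := by
  induction d using Quotient.inductionOn with
  | h G =>
    have hil' : i.1 < l.1 := hil
    refine Quotient.sound (Minor.iso₂₁ (G.blockContractMinor hC2 b M) (blockSubMinor _ hB l)
      (G.blockSubMinor hC a) (fun v => ?_) ⟨fun x y h _ => ?_, fun x L h => h⟩)
    · have := v.2
      simp only [VertexMap.blockSub, VertexMap.blockContract, Block.collapse]
      split_ifs <;> (try simp) <;> (try split_ifs) <;> (try simp [Fin.ext_iff]) <;> omega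
    · simp only [VertexMap.blockSub] at h
      split_ifs at h with h1
      refine (if_neg ?_).symm
      rintro rfl
      omega

/-- Contractions of disjoint blocks commute. -/
theorem blockContract_comm (hA : n + j = A + 1) (hB : n + m = B + 1)
    (hC : A + m = C + 1) (hC2 : B + j = C + 1) (i l : Fin n) (hil : i < l) (a : Fin A)
    (ha : a.1 + 1 = l.1 + j) (b : Fin B) (hb : b.1 = i.1) (L M : VC) (d : Dgm VC FC C) :
    (d.blockContract hC a L).blockContract hA i M =
      (d.blockContract hC2 b M).blockContract hB l L := by
  induction d using Quotient.inductionOn with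
  | h G =>
    have hil' : i.1 < l.1 := hil
    refine Quotient.sound (Minor.iso₂₂ (G.blockContractMinor hC a L) (blockContractMinor _ hA i M)
      (G.blockContractMinor hC2 b M) (blockContractMinor _ hB l L) (fun v => ?_)
      -- Each order creates both new vertices; the one made first is carried along uncoloured by the
      -- second map, so the total colouring does not depend on the order.
      (fun x => if x = i then some M else if x = l then some L else none)
      ⟨fun x y h h' => ?_, fun x L h => ?_⟩ ⟨fun x y h h' => ?_, fun x L h => ?_⟩)
    · have := v.2
      simp only [VertexMap.blockContract, Block.collapse, Option.bind_some, Option.some.injEq,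
        Fin.ext_iff]
      split_ifs <;> omega
    · simp only [VertexMap.blockContract, Block.collapse, Option.some.injEq, Fin.ext_iff] at h h' ⊢
      split_ifs at h h' ⊢ <;> first | rfl | omega
    · simp only [VertexMap.blockContract] at h
      split_ifs at h with h1
      simpa [h1] using h
    · simp only [VertexMap.blockContract, Block.collapse, Option.some.injEq, Fin.ext_iff] at h h' ⊢
      split_ifs at h h' ⊢ <;> first | rfl | omega
    · simp only [VertexMap.blockContract] at h
      split_ifs at h with h1
      simpa [h1, hil.ne'] using h

/-! ### Behaviour under renumbering -/

section Relabel

variable (h : n + j = N + 1) (i : Fin n) (s : Equiv.Perm (Fin n)) (t : Equiv.Perm (Fin j))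
  (ρ : Equiv.Perm (Fin N))

/-- A vertex lies in the block exactly when it collapses to the position of the block. Hence `h1`
makes `ρ` carry the `i`-th block onto the `s i`-th one and preserve the complements, and `h2` says
that it does so by `t`. -/
theorem relabel_blockSub (hj : 0 < j)
    (h1 : ∀ a, Block.collapse h (s i) (ρ a) = s (Block.collapse h i a))
    (h2 : ∀ b, ρ (Block.incl h i b) = Block.incl h (s i) (t b)) (d : Dgm VC FC N) :
    (d.relabel ρ).blockSub h (s i) = (d.blockSub h i).relabel t := by
  induction d using Quotient.inductionOn with
  | h G =>
    refine Quotient.sound (Minor.iso₂₂ (G.relabelMinor ρ) (blockSubMinor _ h (s i))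
      (G.blockSubMinor h i) (relabelMinor _ t) (fun v => ?_) (fun _ => none)
      ⟨fun _ _ _ _ => rfl, fun _ _ h => h⟩ ⟨fun _ _ _ _ => rfl, fun _ _ h => h⟩)
    by_cases hv : i.1 ≤ v.1 ∧ v.1 < i.1 + j
    · obtain ⟨b, rfl⟩ := Block.exists_incl h i v hv
      rw [VertexMap.blockSub_incl]
      simp only [VertexMap.ofEquiv, Option.bind_some, h2]
      rw [VertexMap.blockSub_incl]
    · have hv' := hv
      rw [← Block.collapse_eq_iff h i hj, ← s.apply_eq_iff_eq, ← h1,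
        Block.collapse_eq_iff h _ hj] at hv'
      simp [VertexMap.blockSub, VertexMap.ofEquiv, hv, hv']

theorem relabel_blockContract
    (h1 : ∀ a, Block.collapse h (s i) (ρ a) = s (Block.collapse h i a)) (L : VC)
    (d : Dgm VC FC N) :
    (d.relabel ρ).blockContract h (s i) L = (d.blockContract h i L).relabel s := by
  induction d using Quotient.inductionOn with
  | h G =>
    refine Quotient.sound (Minor.iso₂₂ (G.relabelMinor ρ) (blockContractMinor _ h (s i) L)
      (G.blockContractMinor h i L) (relabelMinor _ s) (fun v => ?_)
      (fun x => if x = s i then some L else none)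
      ⟨fun _ _ _ h' => h', fun _ _ h => h⟩ ⟨fun x y h' _ => ?_, fun _ _ h => by cases h⟩)
    · simp [VertexMap.ofEquiv, VertexMap.blockContract, h1]
    · simp only [VertexMap.ofEquiv, Option.some.injEq] at h'
      simp [VertexMap.blockContract, ← h']

theorem relabel_vertexAt (a : Fin n) (d : Dgm VC FC n) :
    (d.relabel s).vertexAt (s a) = d.vertexAt a := by
  induction d using Quotient.inductionOn with
  | h G =>
    exact Quotient.sound (Minor.iso₂₁ (G.relabelMinor s) (vertexAtMinor _ (s a))
      (G.vertexAtMinor a) (fun v => by simp [VertexMap.ofEquiv, VertexMap.vertexAt])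
      ⟨fun _ _ _ _ => rfl, fun _ _ h => h⟩)

theorem relabel_contractAll (L : VC) (d : Dgm VC FC n) :
    (d.relabel s).contractAll L = d.contractAll L := by
  induction d using Quotient.inductionOn with
  | h G =>
    exact Quotient.sound (Minor.iso₂₁ (G.relabelMinor s) (contractAllMinor _ L)
      (G.contractAllMinor L) (fun v => by simp [VertexMap.ofEquiv, VertexMap.contractAll])
      ⟨fun _ _ _ h => (by cases h), fun _ _ h => h⟩)

end Relabel

theorem blockSub_vertexAt (h : n + j = N + 1) (i : Fin n) (b : Fin j) (d : Dgm VC FC N) :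
    (d.blockSub h i).vertexAt b = d.vertexAt (Block.incl h i b) := by
  induction d using Quotient.inductionOn with
  | h G =>
    refine Quotient.sound (Minor.iso₂₁ (G.blockSubMinor h i) (vertexAtMinor _ b)
      (G.vertexAtMinor _) (fun v => ?_) ⟨fun _ _ _ _ => rfl, fun _ _ h => h⟩)
    simp only [VertexMap.blockSub, VertexMap.vertexAt, Block.incl, Fin.ext_iff]
    split_ifs <;> simp <;> omega

/-- Collapsing is injective over all positions other than `i`, so a vertex outside the block keeps
its flags and colours. Together with `blockSub_vertexAt` this yields the type condition at every
vertex of a composition. -/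
theorem blockContract_vertexAt (h : n + j = N + 1) (hj : 0 < j) (i : Fin n) (L : VC) (v : Fin N)
    (hv : ¬ (i.1 ≤ v.1 ∧ v.1 < i.1 + j)) (d : Dgm VC FC N) :
    (d.blockContract h i L).vertexAt (Block.collapse h i v) = d.vertexAt v := by
  induction d using Quotient.inductionOn with
  | h G =>
    have hi : Block.collapse h i v ≠ i := fun h' => hv ((Block.collapse_eq_iff h i hj v).1 h')
    refine Quotient.sound (Minor.iso₂₁ (G.blockContractMinor h i L) (vertexAtMinor _ _)
      (G.vertexAtMinor v) (fun v' => ?_) ⟨fun x y h' _ => ?_, fun _ _ h => h⟩)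
    · have : Block.collapse h i v' = Block.collapse h i v ↔ v' = v := by
        refine ⟨fun h' => ?_, fun h' => h' ▸ rfl⟩
        exact (VertexMap.blockContract h i L).inj v' v _ rfl (congrArg some h'.symm)
          (if_neg (h' ▸ hi))
      simp [VertexMap.blockContract, VertexMap.vertexAt, this]
    · simp only [VertexMap.vertexAt] at h'
      split_ifs at h' with h1
      simp [VertexMap.blockContract, h1, hi, VertexMap.vertexAt]

/-- The colour `L` is overwritten by the second contraction, and the edges removed in two steps are
those removed in one. So a composition produces the same type of vertex as its outer factor. -/
theorem blockContract_contractAll (h : n + j = N + 1) (i : Fin n) (L K : VC) (d : Dgm VC FC N) :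
    (d.blockContract h i L).contractAll K = d.contractAll K := by
  induction d using Quotient.inductionOn with
  | h G =>
    exact Quotient.sound (Minor.iso₂₁ (G.blockContractMinor h i L) (contractAllMinor _ K)
      (G.contractAllMinor K) (fun v => by simp [VertexMap.blockContract, VertexMap.contractAll])
      ⟨fun _ _ _ h => (by cases h), fun _ _ h => h⟩)

end Dgm

/-! ### The contraction operad -/

section Contraction

variable (k : Type w) [CommRing k] (VC : Type u) [Fintype VC] (FC : Type v)

/-- For the two composition axioms, the sums over the colours of the two new vertices are
interchanged; the terms then agree because the diagrams on which `p`, `q` and `r` are evaluated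
agree. Equivariance is a termwise identity in a single sum. -/
theorem contractionOps_isSymmOperad : (contractionOps k VC FC).IsSymmOperad where
  act_one := by
    intro n p
    funext d K
    exact congrArg (p · K) d.relabel_one
  act_mul := by
    intro n s t p
    funext d K
    exact congrArg (p · K) (d.relabel_mul s t)
  comp_seq := by
    intro n j m A B C hA hB hC hC2 i l a ha p q r
    funext d K
    change ∑ L, r (d.blockSub hC a) L * ∑ M, q ((d.blockContract hC a L).blockSub hA i) M *
        p ((d.blockContract hC a L).blockContract hA i M) K =
      ∑ M, (∑ L, r ((d.blockSub hC2 i).blockSub hB l) L *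
        q ((d.blockSub hC2 i).blockContract hB l L) M) * p (d.blockContract hC2 i M) K
    simp only [Finset.mul_sum, Finset.sum_mul]
    rw [Finset.sum_comm]
    refine Finset.sum_congr rfl fun M _ => Finset.sum_congr rfl fun L _ => ?_
    rw [Dgm.blockSub_blockSub hB hC hC2 i l a ha,
      Dgm.blockSub_blockContract hA hB hC hC2 i l a ha,
      Dgm.blockContract_blockContract hA hB hC hC2 i l a ha, mul_assoc]
  comp_par := by
    intro n j m A B C hA hB hC hC2 i l hil a ha b hb p q r
    funext d K
    change ∑ L, r (d.blockSub hC a) L * ∑ M, q ((d.blockContract hC a L).blockSub hA i) M *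
        p ((d.blockContract hC a L).blockContract hA i M) K =
      ∑ M, q (d.blockSub hC2 b) M * ∑ L, r ((d.blockContract hC2 b M).blockSub hB l) L *
        p ((d.blockContract hC2 b M).blockContract hB l L) K
    simp only [Finset.mul_sum]
    rw [Finset.sum_comm]
    refine Finset.sum_congr rfl fun M _ => Finset.sum_congr rfl fun L _ => ?_
    rw [Dgm.blockSub_blockContract_right hA hB hC hC2 i l hil a ha b hb,
      Dgm.blockSub_blockContract_left hA hB hC hC2 i l hil a ha b hb,
      Dgm.blockContract_comm hA hB hC hC2 i l hil a ha b hb, mul_left_comm]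
  comp_act := by
    intro n j N h i s t ρ h1 h2 p q
    funext d K
    change ∑ L, q ((d.blockSub h i).relabel t) L * p ((d.blockContract h i L).relabel s) K =
      ∑ L, q ((d.relabel ρ).blockSub h (s i)) L * p ((d.relabel ρ).blockContract h (s i) L) K
    refine Finset.sum_congr rfl fun L _ => ?_
    rw [Dgm.relabel_blockSub h i s t ρ j.pos h1 h2, Dgm.relabel_blockContract h i s ρ h1]

variable {k VC FC} in
/-- Stable submodules of an operad form an operad. -/
theorem OperadOps.IsSymmOperad.restrict {P : OperadOps.{w, x} k} (hP : P.IsSymmOperad)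
    (S : ∀ n : ℕ+, Submodule k (P.obj n)) (hS : P.IsStable S) :
    (P.restrict S hS).IsSymmOperad where
  act_one := fun p => Subtype.ext (hP.act_one p.1)
  act_mul := fun s t p => Subtype.ext (hP.act_mul s t p.1)
  comp_seq := fun hA hB hC hC2 i l a ha p q r =>
    Subtype.ext (hP.comp_seq hA hB hC hC2 i l a ha p.1 q.1 r.1)
  comp_par := fun hA hB hC hC2 i l hil a ha b hb p q r =>
    Subtype.ext (hP.comp_par hA hB hC hC2 i l hil a ha b hb p.1 q.1 r.1)
  comp_act := fun h i s t ρ h1 h2 p q =>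
    Subtype.ext (hP.comp_act h i s t ρ h1 h2 p.1 q.1)

end Contraction

/-! ### Gluing connectedness along a contraction -/

namespace FGraph

variable {VC : Type u} {FC : Type v} {V W : Type} {n j N : ℕ}

/-- `G` remains connected without the edges in `X`: a property of vertices that is inherited along
all edges outside `X` is constant. -/
def ConnOff (G : FGraph VC FC V) (X : Set G.Flag) : Prop :=
  ∀ P : V → Prop, (∀ g, g ∉ X → P (G.att g) → P (G.att (G.inv g))) → ∀ a b, P a → P b

/-- Induction along a walk spreads a property; conversely, being reachable from `a` is itself a
property that spreads along edges. This form of connectedness is easy to push through a contraction.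
-/
theorem connected_iff (G : FGraph VC FC V) : G.Connected ↔ Nonempty V ∧ G.ConnOff ∅ := by
  unfold Connected
  rw [SimpleGraph.connected_iff, and_comm]
  refine and_congr_right fun _ => ⟨fun h P hP a b ha => ?_, fun h a b => ?_⟩
  · obtain ⟨p⟩ := h a b
    induction p with
    | nil => exact ha
    | cons hadj _ ih =>
      apply ih
      rw [adjacency, SimpleGraph.fromRel_adj] at hadj
      rcases hadj.2 with ⟨f, rfl, rfl⟩ | ⟨f, rfl, rfl⟩
      · exact hP f id ha
      · have := hP (G.inv f) id ha
        rwa [G.inv_inv] at this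
  · refine h (fun c => G.adjacency.Reachable a c) (fun g _ hg => ?_) a b .rfl
    by_cases he : G.att g = G.att (G.inv g)
    · rwa [← he]
    · refine hg.trans (SimpleGraph.Adj.reachable ?_)
      rw [adjacency, SimpleGraph.fromRel_adj]
      exact ⟨he, Or.inl ⟨g, rfl, rfl⟩⟩

theorem cut_inv (G : FGraph VC FC V) (f g : G.Flag) :
    (G.cut f).inv g = if g = f ∨ g = G.inv f then g else G.inv g := rfl

/-- Cutting makes the involution trivial at the two flags of the edge, where the inheritance
condition becomes vacuous. -/
theorem cut_connOff (G : FGraph VC FC V) (f : G.Flag) :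
    (G.cut f).ConnOff ∅ ↔ G.ConnOff {f, G.inv f} := by
  refine forall_congr' fun P => imp_congr_left (forall_congr' fun g => ?_)
  by_cases h : g = f ∨ g = G.inv f
  · have e : P (G.att ((G.cut f).inv g)) = P (G.att g) :=
      congrArg (fun x => P (G.att x)) ((G.cut_inv f g).trans (if_pos h))
    exact ⟨fun _ hn => absurd h hn, fun _ _ => e.mpr⟩
  · have e : P (G.att ((G.cut f).inv g)) = P (G.att (G.inv g)) :=
      congrArg (fun x => P (G.att x)) ((G.cut_inv f g).trans (if_neg h))
    exact ⟨fun hp _ hg => e.mp (hp id hg), fun hp _ hg => e.mpr (hp h hg)⟩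

theorem onePI_iff (G : FGraph VC FC V) :
    G.OnePI ↔ (Nonempty V ∧ G.ConnOff ∅) ∧ (∀ f, G.inv f ≠ f → G.ConnOff {f, G.inv f}) ∧
      G.NoTadpole ∧ 2 ≤ Nat.card V := by
  rw [OnePI, connected_iff]
  refine and_congr_right fun h => and_congr_left' (forall_congr' fun f => imp_congr_right fun _ => ?_)
  rw [connected_iff, cut_connOff]
  exact and_iff_right h.1

theorem NoTadpole.relabel {G : FGraph VC FC V} (hG : G.NoTadpole) (e : V ≃ W) :
    (G.relabel e).NoTadpole := fun f hf h => hG f hf (e.injective h)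

theorem Admissible.relabel {Adm : Set (FC × FC)} {G : FGraph VC FC V} (hG : G.Admissible Adm)
    (e : V ≃ W) : (G.relabel e).Admissible Adm := hG

theorem ConnOff.relabel {G : FGraph VC FC V} {Y : Set G.Flag} (hG : G.ConnOff Y) (e : V ≃ W) :
    (G.relabel e).ConnOff Y := fun P hP a b ha => by
  have := hG (fun v => P (e v)) hP (e.symm a) (e.symm b)
  simpa [ha] using this

theorem OnePI.relabel {G : FGraph VC FC V} (hG : G.OnePI) (e : V ≃ W) : (G.relabel e).OnePI := by
  rw [onePI_iff] at hG ⊢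
  exact ⟨⟨hG.1.1.map e, hG.1.2.relabel e⟩, fun f hf => (hG.2.1 f hf).relabel e,
    hG.2.2.1.relabel e, by rw [← Nat.card_congr e]; exact hG.2.2.2⟩

section Glue

variable {G : FGraph VC FC (Fin N)} {h : n + j = N + 1} {i : Fin n} {L : VC}
  {H₁ : FGraph VC FC (Fin j)} {H₂ : FGraph VC FC (Fin n)}

theorem Minor.blockSub_att (m₁ : Minor (VertexMap.blockSub VC h i) G H₁)
    (f : H₁.Flag) : G.att (m₁.e f) = Block.incl h i (H₁.att f) :=
  Fin.ext ((VertexMap.blockSub_eq_some h i VC _ _).1 (m₁.att f))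

theorem Minor.blockSub_inv (m₁ : Minor (VertexMap.blockSub VC h i) G H₁)
    (f : H₁.Flag) (hf : H₁.inv f ≠ f) :
    m₁.e (H₁.inv f) = G.inv (m₁.e f) := by
  have := m₁.inv f
  split_ifs at this with h0
  · exact absurd (m₁.inj this) hf
  · exact this

theorem Minor.blockContract_att (m₂ : Minor (VertexMap.blockContract h i L) G H₂)
    (f : H₂.Flag) :
    Block.collapse h i (G.att (m₂.e f)) = H₂.att f :=
  Option.some_injective _ (m₂.att f)

theorem Minor.blockContract_inv (m₂ : Minor (VertexMap.blockContract h i L) G H₂)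
    (f : H₂.Flag) : m₂.e (H₂.inv f) = G.inv (m₂.e f) :=
  (m₂.inv f).trans (if_neg (by simp [VertexMap.blockContract]))

theorem _root_.Block.collapse_incl (h : n + j = N + 1) (i : Fin n) (b : Fin j) :
    Block.collapse h i (Block.incl h i b) = i := by
  have := b.2
  simp only [Block.collapse, Block.incl, Fin.ext_iff]
  grind

theorem _root_.Block.eq_or_exists_incl (h : n + j = N + 1) (hj : 0 < j) (i : Fin n) {v v' : Fin N}
    (hv : Block.collapse h i v = Block.collapse h i v') :
    v = v' ∨ ∃ b b', Block.incl h i b = v ∧ Block.incl h i b' = v' := by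
  by_cases hi : Block.collapse h i v = i
  · have hi' := hv ▸ hi
    obtain ⟨b, hb⟩ := Block.exists_incl h i v ((Block.collapse_eq_iff h i hj v).1 hi)
    obtain ⟨b', hb'⟩ := Block.exists_incl h i v' ((Block.collapse_eq_iff h i hj v').1 hi')
    exact Or.inr ⟨b, b', hb, hb'⟩
  · refine Or.inl ?_
    simp only [Block.collapse, Fin.ext_iff] at hi hv ⊢
    split_ifs at hi hv <;> omega

/-- Connectedness of the subgraph makes an inherited property constant on the block, hence on all
fibres of the collapse, and connectedness of the contraction does the rest. Edges forbidden in `G`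
must be forbidden in the pieces too, unless they are external lines there. -/
theorem ConnOff.glue (m₁ : Minor (VertexMap.blockSub VC h i) G H₁)
    (m₂ : Minor (VertexMap.blockContract h i L) G H₂)
    (hj : 0 < j) {X : Set G.Flag} {Y₁ : Set H₁.Flag} {Y₂ : Set H₂.Flag}
    (h₁ : H₁.ConnOff Y₁) (h₂ : H₂.ConnOff Y₂)
    (hX₁ : ∀ f, m₁.e f ∈ X → f ∈ Y₁ ∨ H₁.inv f = f)
    (hX₂ : ∀ f, m₂.e f ∈ X → f ∈ Y₂ ∨ H₂.inv f = f) : G.ConnOff X := by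
  intro P hP
  have hblock : ∀ b b', P (Block.incl h i b) → P (Block.incl h i b') := by
    refine h₁ (fun b => P (Block.incl h i b)) fun f hf hp => ?_
    by_cases hi : H₁.inv f = f
    · rwa [hi]
    · rw [← m₁.blockSub_att] at hp ⊢
      rw [m₁.blockSub_inv f hi]
      exact hP _ (fun hx => (hX₁ f hx).elim hf hi) hp
  have hfib : ∀ v v', Block.collapse h i v = Block.collapse h i v' → P v → P v' := by
    intro v v' hv hp
    rcases Block.eq_or_exists_incl h hj i hv with rfl | ⟨b, b', rfl, rfl⟩
    · exact hp
    · exact hblock b b' hp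
  -- The property descends to the contraction as an existence statement over the fibre; `hfib` makes
  -- the choice of `v` immaterial.
  have hall := h₂ (fun w => ∃ v, Block.collapse h i v = w ∧ P v) (by
    rintro f hf ⟨v, hv, hp⟩
    by_cases hi : H₂.inv f = f
    · rw [hi]
      exact ⟨v, hv, hp⟩
    · rw [← m₂.blockContract_att] at hv ⊢
      refine ⟨_, rfl, ?_⟩
      rw [m₂.blockContract_inv]
      exact hP _ (fun hx => (hX₂ f hx).elim hf hi) (hfib _ _ hv hp))
  intro a b ha
  obtain ⟨v, hv, hp⟩ := hall (Block.collapse h i a) (Block.collapse h i b) ⟨a, rfl, ha⟩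
  exact hfib v b hv hp

/-- An inner edge survives either in the subgraph on the block or in the contraction. -/
theorem edge_cases (m₁ : Minor (VertexMap.blockSub VC h i) G H₁)
    (m₂ : Minor (VertexMap.blockContract h i L) G H₂)
    (f : G.Flag) (hf : G.inv f ≠ f) :
    (∃ f₁, m₁.e f₁ = f ∧ m₁.e (H₁.inv f₁) = G.inv f ∧ H₁.inv f₁ ≠ f₁ ∧ ∀ f₂, m₂.e f₂ ≠ f) ∨
    (∃ f₂, m₂.e f₂ = f ∧ H₂.inv f₂ ≠ f₂ ∧ ∀ f₁, m₁.e f₁ = f → H₁.inv f₁ = f₁) := by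
  by_cases hb : (∃ b, (VertexMap.blockSub VC h i).p (G.att f) = some b) ∧
      ∃ b, (VertexMap.blockSub VC h i).p (G.att (G.inv f)) = some b
  · obtain ⟨⟨b, hb⟩, ⟨b', hb'⟩⟩ := hb
    obtain ⟨f₁, rfl⟩ := (m₁.range f b hb).2 fun _ _ => rfl
    have hi := m₁.inv f₁
    rw [if_neg (by simp [hb'])] at hi
    refine Or.inl ⟨f₁, rfl, hi, fun h0 => hf (by rw [← hi, h0]), fun f₂ h2 => ?_⟩
    have hv : G.att (m₁.e f₁) = Block.incl h i b :=
      Fin.ext ((VertexMap.blockSub_eq_some h i VC _ _).1 hb)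
    have hv' : G.att (G.inv (m₁.e f₁)) = Block.incl h i b' :=
      Fin.ext ((VertexMap.blockSub_eq_some h i VC _ _).1 hb')
    have := (m₂.range (m₁.e f₁) i (by
      simp [VertexMap.blockContract, hv, Block.collapse_incl])).1 ⟨f₂, h2⟩ hf (by
      simp [VertexMap.blockContract, hv', Block.collapse_incl])
    simp [VertexMap.blockContract] at this
  · obtain ⟨f₂, rfl⟩ := (m₂.range f _ rfl).2 (by
      intro _ h0
      refine if_neg fun h1 => hb ?_
      have h2 : Block.collapse h i (G.att (G.inv f)) = i := (Option.some_injective _ h0).trans h1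
      -- No vertex collapses to the position of an empty block.
      have hj : 0 < j := by
        by_contra hj
        simp only [Block.collapse, Fin.ext_iff] at h2
        split_ifs at h2 <;> omega
      obtain ⟨b, hb⟩ := Block.exists_incl h i _ ((Block.collapse_eq_iff h i hj _).1 h1)
      obtain ⟨b', hb'⟩ := Block.exists_incl h i _ ((Block.collapse_eq_iff h i hj _).1 h2)
      rw [← hb, ← hb']
      exact ⟨⟨b, VertexMap.blockSub_incl h i VC b⟩, ⟨b', VertexMap.blockSub_incl h i VC b'⟩⟩)
    refine Or.inr ⟨f₂, rfl, fun h0 => hf (by rw [← m₂.blockContract_inv, h0]), fun f₁ h1 => ?_⟩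
    by_contra h2
    have h3 := m₁.blockSub_inv f₁ h2
    refine hb ⟨⟨_, by rw [← h1]; exact m₁.att f₁⟩, ⟨H₁.att (H₁.inv f₁), ?_⟩⟩
    rw [← h1, ← h3]
    exact m₁.att _

theorem NoTadpole.glue (m₁ : Minor (VertexMap.blockSub VC h i) G H₁)
    (m₂ : Minor (VertexMap.blockContract h i L) G H₂)
    (h₁ : H₁.NoTadpole) (h₂ : H₂.NoTadpole) : G.NoTadpole := by
  intro f hf
  rcases edge_cases m₁ m₂ f hf with ⟨f₁, rfl, h3, h4, -⟩ | ⟨f₂, rfl, h4, -⟩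
  · rw [← h3, m₁.blockSub_att, m₁.blockSub_att]
    intro h5
    exact h₁ f₁ h4 (Option.some_injective _ (by
      rw [← VertexMap.blockSub_incl h i VC, h5, VertexMap.blockSub_incl]))
  · intro h5
    apply h₂ f₂ h4
    rw [← m₂.blockContract_att, ← m₂.blockContract_att, m₂.blockContract_inv, h5]

theorem Admissible.glue (m₁ : Minor (VertexMap.blockSub VC h i) G H₁)
    (m₂ : Minor (VertexMap.blockContract h i L) G H₂)
    {Adm : Set (FC × FC)} (h₁ : H₁.Admissible Adm) (h₂ : H₂.Admissible Adm) :
    G.Admissible Adm := by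
  intro f hf
  rcases edge_cases m₁ m₂ f hf with ⟨f₁, rfl, h3, h4, -⟩ | ⟨f₂, rfl, h4, -⟩
  · rw [← h3, ← m₁.fcol, ← m₁.fcol]
    exact h₁ f₁ h4
  · rw [← m₂.blockContract_inv, ← m₂.fcol, ← m₂.fcol]
    exact h₂ f₂ h4

/-- Cutting an edge of `G` amounts to cutting one edge in one of the two pieces and nothing in the
other, so both stay connected. -/
theorem OnePI.glue (m₁ : Minor (VertexMap.blockSub VC h i) G H₁)
    (m₂ : Minor (VertexMap.blockContract h i L) G H₂)
    (h₁ : H₁.OnePI) (h₂ : H₂.OnePI) : G.OnePI := by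
  rw [onePI_iff] at h₁ h₂ ⊢
  have hj : 2 ≤ j := by simpa only [Nat.card_eq_fintype_card, Fintype.card_fin] using h₁.2.2.2
  have hn : 2 ≤ n := by simpa only [Nat.card_eq_fintype_card, Fintype.card_fin] using h₂.2.2.2
  refine ⟨⟨⟨⟨0, by omega⟩⟩, ConnOff.glue m₁ m₂ (by omega) h₁.1.2 h₂.1.2 (fun _ h => h.elim)
    fun _ h => h.elim⟩, fun f hf => ?_, NoTadpole.glue m₁ m₂ h₁.2.2.1 h₂.2.2.1, ?_⟩
  · rcases edge_cases m₁ m₂ f hf with ⟨f₁, rfl, h3, h4, h5⟩ | ⟨f₂, rfl, h4, h5⟩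
    · refine ConnOff.glue m₁ m₂ (by omega) (h₁.2.1 f₁ h4) h₂.1.2 (fun g hg => ?_) fun g hg => ?_
      · rcases hg with hg | hg
        · exact Or.inl (Or.inl (m₁.inj hg))
        · exact Or.inl (Or.inr (m₁.inj (hg.trans h3.symm)))
      · rcases hg with hg | hg
        · exact absurd hg (h5 g)
        · refine absurd ?_ (h5 (H₂.inv g))
          rw [m₂.blockContract_inv, hg, G.inv_inv]
    · refine ConnOff.glue m₁ m₂ (by omega) h₁.1.2 (h₂.2.1 f₂ h4) (fun g hg => ?_) fun g hg => ?_
      · rcases hg with hg | hg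
        · exact Or.inr (h5 g hg)
        -- If the partner of the cut flag appears in the block it is an external line there:
        -- otherwise its own partner, the cut flag, would be joined inside the block.
        · refine Or.inr ?_
          by_contra h6
          have h7 := h5 (H₁.inv g) (by rw [m₁.blockSub_inv g h6, hg, G.inv_inv])
          rw [H₁.inv_inv] at h7
          exact h6 h7.symm
      · rcases hg with hg | hg
        · exact Or.inl (Or.inl (m₂.inj hg))
        · exact Or.inl (Or.inr (m₂.inj (hg.trans (m₂.blockContract_inv f₂).symm)))
  · simp only [Nat.card_eq_fintype_card, Fintype.card_fin]
    omega

end Glue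

end FGraph

/-! ### Stability of the theory submodules -/

section Contraction

variable {k : Type w} [CommRing k] {VC : Type u} {FC : Type v}

theorem mem_theorySub {Adm : Set (FC × FC)} {T : Set (Dgm VC FC 1)} {n : ℕ}
    {Q : ContractionMap k VC FC n} :
    Q ∈ theorySub k Adm T n ↔ ∀ d L, Q d L ≠ 0 →
      (∃ G, Dgm.mk G = d ∧ G.OnePI) ∧ (∃ G, Dgm.mk G = d ∧ G.Admissible Adm ∧ G.NoTadpole) ∧
      (∀ a, d.vertexAt a ∈ T) ∧ d.contractAll L ∈ T := by
  constructor
  · rintro ⟨⟨h1, h2⟩, h3⟩ d L h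
    exact ⟨by_contra fun h' => h (h1 d L h'), by_contra fun h' => h (h2 d L h'),
      by_contra fun h' => h (h3 d L h')⟩
  · intro h
    exact ⟨⟨fun d L h' => by_contra fun h0 => h' (h d L h0).1,
      fun d L h' => by_contra fun h0 => h' (h d L h0).2.1⟩,
      fun d L h' => by_contra fun h0 => h' (h d L h0).2.2⟩

/-- The support conditions provide some representative of the class of the subgraph, not the
subgraph itself; any representative is equally good as a minor. -/
theorem Dgm.exists_blockSubMinor {n j N : ℕ} (h : n + j = N + 1) (i : Fin n)
    (G : FGraph VC FC (Fin N)) (H : FGraph VC FC (Fin j))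
    (hH : Dgm.mk H = (Dgm.mk G).blockSub h i) :
    Nonempty (FGraph.Minor (VertexMap.blockSub VC h i) G H) :=
  (G.blockSubMinor h i).of_iso (Quotient.exact hH.symm)

theorem Dgm.exists_blockContractMinor {n j N : ℕ} (h : n + j = N + 1) (i : Fin n) (L : VC)
    (G : FGraph VC FC (Fin N)) (H : FGraph VC FC (Fin n))
    (hH : Dgm.mk H = (Dgm.mk G).blockContract h i L) :
    Nonempty (FGraph.Minor (VertexMap.blockContract h i L) G H) :=
  (G.blockContractMinor h i L).of_iso (Quotient.exact hH.symm)

theorem Dgm.exists_mk_relabel {n : ℕ} (s : Equiv.Perm (Fin n)) (d : Dgm VC FC n)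
    (G : FGraph VC FC (Fin n)) (hG : Dgm.mk G = d.relabel s) : Dgm.mk (G.relabel s⁻¹) = d := by
  change (Dgm.mk G).relabel s⁻¹ = d
  rw [hG, ← Dgm.relabel_mul, inv_mul_cancel, Dgm.relabel_one]

variable (k) in
theorem theorySub_isStable [Fintype VC] (Adm : Set (FC × FC)) (T : Set (Dgm VC FC 1)) :
    (contractionOps k VC FC).IsStable (fun n => theorySub k Adm T n) where
  act_mem := by
    intro n s Q hQ
    replace hQ := mem_theorySub.1 hQ
    refine mem_theorySub.2 ?_
    intro d L h
    obtain ⟨⟨G, hG, h1⟩, ⟨G', hG', h2, h3⟩, h4, h5⟩ := hQ (d.relabel s) L h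
    refine ⟨⟨_, Dgm.exists_mk_relabel s d G hG, h1.relabel _⟩,
      ⟨_, Dgm.exists_mk_relabel s d G' hG', h2.relabel _, h3.relabel _⟩, fun a => ?_, ?_⟩
    · rw [← Dgm.relabel_vertexAt s]
      exact h4 _
    · rwa [← Dgm.relabel_contractAll s]
  comp_mem := by
    intro n j N h i p q hp hq
    replace hp := mem_theorySub.1 hp
    replace hq := mem_theorySub.1 hq
    refine mem_theorySub.2 ?_
    intro d K hd
    -- A nonzero matrix element has a nonzero summand, and for its `L` both factors satisfy the
    -- support conditions.
    obtain ⟨L, -, hL⟩ := Finset.exists_ne_zero_of_sum_ne_zero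
      (show ∑ L : VC, q (d.blockSub h i) L * p (d.blockContract h i L) K ≠ 0 from hd)
    obtain ⟨⟨G₁, hG₁, h1⟩, ⟨G₁', hG₁', h2, h3⟩, h4, -⟩ := hq _ _ (left_ne_zero_of_mul hL)
    obtain ⟨⟨G₂, hG₂, g1⟩, ⟨G₂', hG₂', g2, g3⟩, g4, g5⟩ := hp _ _ (right_ne_zero_of_mul hL)
    refine ⟨?_, ?_, fun v => ?_, by rwa [Dgm.blockContract_contractAll] at g5⟩
    · obtain ⟨G, rfl⟩ := Quotient.exists_rep d
      obtain ⟨m₁⟩ := Dgm.exists_blockSubMinor h i G G₁ hG₁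
      obtain ⟨m₂⟩ := Dgm.exists_blockContractMinor h i L G G₂ hG₂
      exact ⟨G, rfl, FGraph.OnePI.glue m₁ m₂ h1 g1⟩
    · obtain ⟨G, rfl⟩ := Quotient.exists_rep d
      obtain ⟨m₁⟩ := Dgm.exists_blockSubMinor h i G G₁' hG₁'
      obtain ⟨m₂⟩ := Dgm.exists_blockContractMinor h i L G G₂' hG₂'
      exact ⟨G, rfl, FGraph.Admissible.glue m₁ m₂ h2 g2, FGraph.NoTadpole.glue m₁ m₂ h3 g3⟩
    · by_cases hv : i.1 ≤ v.1 ∧ v.1 < i.1 + j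
      · obtain ⟨b, rfl⟩ := Block.exists_incl h i v hv
        rw [← Dgm.blockSub_vertexAt]
        exact h4 b
      · rw [← Dgm.blockContract_vertexAt h j.pos i L v hv]
        exact g4 _

end Contraction

/-! ### The endomorphism operad -/

section EndOperad

variable {E : Type x} {n j m A B C N : ℕ}

theorem outerArgs_self (h : n + j = N + 1) (i : Fin n) (z : Fin N → E) (y : E) :
    outerArgs h i z y i = y := by
  have : (Block.contractEquiv h i).symm i = none := by
    rw [Equiv.symm_apply_eq]
    rfl
  simp [outerArgs, this]

/-- With `outerArgs_self` this determines the outer arguments, since each position is `i` or the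
image of a vertex outside the block. -/
theorem outerArgs_collapse (h : n + j = N + 1) (i : Fin n) (z : Fin N → E) (y : E) (v : Fin N)
    (hv : ¬ (i.1 ≤ v.1 ∧ v.1 < i.1 + j)) : outerArgs h i z y (Block.collapse h i v) = z v := by
  have : (Block.contractEquiv h i).symm (Block.collapse h i v) = some ⟨v, hv⟩ := by
    rw [Equiv.symm_apply_eq]
    rfl
  simp [outerArgs, this]

theorem Block.eq_or_exists_collapse (h : n + j = N + 1) (i b : Fin n) :
    b = i ∨ ∃ v, ¬ (i.1 ≤ v.1 ∧ v.1 < i.1 + j) ∧ Block.collapse h i v = b := by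
  rcases hc : (Block.contractEquiv h i).symm b with _ | v
  · rw [Equiv.symm_apply_eq] at hc
    exact Or.inl hc
  · rw [Equiv.symm_apply_eq] at hc
    exact Or.inr ⟨v.1, v.2, hc.symm⟩

/-- The outer arguments as a function of the position. -/
theorem outerArgs_apply_of_lt (h : n + j = N + 1) (i : Fin n) (z : Fin N → E) (y : E) (b : Fin n)
    (v : Fin N) (hb : b.1 < i.1) (hv : v.1 = b.1) : outerArgs h i z y b = z v := by
  rw [← outerArgs_collapse h i z y v (by omega)]
  congr 1
  simp only [Block.collapse, Fin.ext_iff]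
  split_ifs <;> omega

theorem outerArgs_apply_of_gt (h : n + j = N + 1) (i : Fin n) (z : Fin N → E) (y : E) (b : Fin n)
    (v : Fin N) (hb : i.1 < b.1) (hv : v.1 + 1 = b.1 + j) : outerArgs h i z y b = z v := by
  rw [← outerArgs_collapse h i z y v (by omega)]
  congr 1
  simp only [Block.collapse, Fin.ext_iff]
  split_ifs <;> omega

/-- Outer arguments of a composition in the block of the inner map. -/
theorem outerArgs_outerArgs_seq (hA : n + j = A + 1) (hB : j + m = B + 1)
    (hC : A + m = C + 1) (hC2 : n + B = C + 1) (i : Fin n) (l : Fin j) (a : Fin A)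
    (ha : a.1 = i.1 + l.1) (z : Fin C → E) (x y : E) :
    outerArgs hA i (outerArgs hC a z y) x = outerArgs hC2 i z x := by
  have := l.2
  funext b
  have := b.2
  rcases lt_trichotomy b.1 i.1 with hb | hb | hb
  · rw [outerArgs_apply_of_lt hC2 i z x b ⟨b.1, by omega⟩ hb rfl,
      outerArgs_apply_of_lt hA i _ x b ⟨b.1, by omega⟩ hb rfl,
      outerArgs_apply_of_lt hC a z y _ ⟨b.1, by omega⟩ (by simp only; omega) rfl]
  · obtain rfl := Fin.ext hb
    rw [outerArgs_self, outerArgs_self]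
  · rw [outerArgs_apply_of_gt hC2 i z x b ⟨b.1 + B - 1, by omega⟩ hb (by simp only; omega),
      outerArgs_apply_of_gt hA i _ x b ⟨b.1 + j - 1, by omega⟩ hb (by simp only; omega),
      outerArgs_apply_of_gt hC a z y _ ⟨b.1 + B - 1, by omega⟩ (by simp only; omega)
        (by simp only; omega)]

theorem outerArgs_incl_seq (hA : n + j = A + 1) (hB : j + m = B + 1)
    (hC : A + m = C + 1) (hC2 : n + B = C + 1) (i : Fin n) (l : Fin j) (a : Fin A)
    (ha : a.1 = i.1 + l.1) (z : Fin C → E) (y : E) :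
    (fun b => outerArgs hC a z y (Block.incl hA i b)) =
      outerArgs hB l (fun b => z (Block.incl hC2 i b)) y := by
  have := i.2
  funext b
  have := b.2
  rcases lt_trichotomy b.1 l.1 with hb | hb | hb
  · rw [outerArgs_apply_of_lt hB l _ y b ⟨b.1, by omega⟩ hb rfl,
      outerArgs_apply_of_lt hC a z y _ (Block.incl hC2 i ⟨b.1, by omega⟩)
        (by simp only [Block.incl]; omega) rfl]
  · obtain rfl := Fin.ext hb
    obtain rfl : a = Block.incl hA i b := Fin.ext ha
    rw [outerArgs_self, outerArgs_self]
  · rw [outerArgs_apply_of_gt hB l _ y b ⟨b.1 + m - 1, by omega⟩ hb (by simp only; omega),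
      outerArgs_apply_of_gt hC a z y _ (Block.incl hC2 i ⟨b.1 + m - 1, by omega⟩)
        (by simp only [Block.incl]; omega) (by simp only [Block.incl]; omega)]

/-- Outer arguments of compositions at different positions. -/
theorem outerArgs_outerArgs_par (hA : n + j = A + 1) (hB : n + m = B + 1)
    (hC : A + m = C + 1) (hC2 : B + j = C + 1) (i l : Fin n) (hil : i < l) (a : Fin A)
    (ha : a.1 + 1 = l.1 + j) (b : Fin B) (hb : b.1 = i.1) (z : Fin C → E) (x y : E) :
    outerArgs hA i (outerArgs hC a z y) x = outerArgs hB l (outerArgs hC2 b z x) y := by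
  have hil' : i.1 < l.1 := hil
  funext c
  have := c.2
  have := a.2
  have := b.2
  rcases lt_trichotomy c.1 i.1 with hc | hc | hc
  · rw [outerArgs_apply_of_lt hA i _ x c ⟨c.1, by omega⟩ hc rfl,
      outerArgs_apply_of_lt hC a z y _ ⟨c.1, by omega⟩ (by simp only; omega) rfl,
      outerArgs_apply_of_lt hB l _ y c ⟨c.1, by omega⟩ (by omega) rfl,
      outerArgs_apply_of_lt hC2 b z x _ ⟨c.1, by omega⟩ (by simp only; omega) rfl]
  · obtain rfl := Fin.ext hc
    rw [outerArgs_self, outerArgs_apply_of_lt hB l _ y c b (by omega) hb, outerArgs_self]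
  · have hj : c.1 + j - 1 < A := by omega
    rcases lt_trichotomy c.1 l.1 with hd | hd | hd
    · rw [outerArgs_apply_of_gt hA i _ x c ⟨c.1 + j - 1, by omega⟩ hc (by simp only; omega),
        outerArgs_apply_of_lt hC a z y _ ⟨c.1 + j - 1, by omega⟩ (by simp only; omega) rfl,
        outerArgs_apply_of_lt hB l _ y c ⟨c.1, by omega⟩ (by omega) rfl,
        outerArgs_apply_of_gt hC2 b z x _ ⟨c.1 + j - 1, by omega⟩ (by simp only; omega)
          (by simp only; omega)]
    · obtain rfl := Fin.ext hd
      rw [outerArgs_self, outerArgs_apply_of_gt hA i _ x c a (by omega) ha, outerArgs_self]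
    · rw [outerArgs_apply_of_gt hA i _ x c ⟨c.1 + j - 1, by omega⟩ hc (by simp only; omega),
        outerArgs_apply_of_gt hC a z y _ ⟨c.1 + j - 1 + m - 1, by omega⟩ (by simp only; omega)
          (by simp only; omega),
        outerArgs_apply_of_gt hB l _ y c ⟨c.1 + m - 1, by omega⟩ hd (by simp only; omega),
        outerArgs_apply_of_gt hC2 b z x _ ⟨c.1 + j - 1 + m - 1, by omega⟩ (by simp only; omega)
          (by simp only; omega)]

theorem outerArgs_incl_left (hA : n + j = A + 1) (hB : n + m = B + 1)
    (hC : A + m = C + 1) (hC2 : B + j = C + 1) (i l : Fin n) (hil : i < l) (a : Fin A)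
    (ha : a.1 + 1 = l.1 + j) (b : Fin B) (hb : b.1 = i.1) (z : Fin C → E) (y : E) :
    (fun c => outerArgs hC a z y (Block.incl hA i c)) = fun c => z (Block.incl hC2 b c) := by
  have hil' : i.1 < l.1 := hil
  funext c
  have := c.2
  rw [outerArgs_apply_of_lt hC a z y _ (Block.incl hC2 b c) (by simp only [Block.incl]; omega)
    (by simp only [Block.incl]; omega)]

theorem outerArgs_incl_right (hA : n + j = A + 1) (hB : n + m = B + 1)
    (hC : A + m = C + 1) (hC2 : B + j = C + 1) (i l : Fin n) (hil : i < l) (a : Fin A)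
    (ha : a.1 + 1 = l.1 + j) (b : Fin B) (hb : b.1 = i.1) (z : Fin C → E) (x : E) :
    (fun c => outerArgs hC2 b z x (Block.incl hB l c)) = fun c => z (Block.incl hC a c) := by
  have hil' : i.1 < l.1 := hil
  funext c
  have := c.2
  rw [outerArgs_apply_of_gt hC2 b z x _ (Block.incl hC a c) (by simp only [Block.incl]; omega)
    (by simp only [Block.incl]; omega)]

theorem outerArgs_relabel (h : n + j = N + 1) (hj : 0 < j) (i : Fin n) (s : Equiv.Perm (Fin n))
    (ρ : Equiv.Perm (Fin N)) (h1 : ∀ a, Block.collapse h (s i) (ρ a) = s (Block.collapse h i a))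
    (z : Fin N → E) (y : E) :
    (fun b => outerArgs h i z y (s.symm b)) = outerArgs h (s i) (fun a => z (ρ.symm a)) y := by
  funext b
  obtain ⟨c, rfl⟩ := s.surjective b
  rw [Equiv.symm_apply_apply]
  rcases Block.eq_or_exists_collapse h i c with rfl | ⟨v, hv, rfl⟩
  · rw [outerArgs_self, outerArgs_self]
  · rw [outerArgs_collapse h i z y v hv, ← h1, outerArgs_collapse, Equiv.symm_apply_apply]
    rwa [← Block.collapse_eq_iff h _ hj, h1, s.apply_eq_iff_eq, Block.collapse_eq_iff h i hj]

variable (k : Type w) [CommRing k] (E) [AddCommGroup E] [Module k E]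

/-- The objects of `endOps` are multilinear maps only after unfolding, so the coercions are spelled
out to allow rewriting. -/
theorem endOps_comp_apply {n j N : ℕ+} (h : (n : ℕ) + j = N + 1) (i : Fin n)
    (f : (endOps k E).obj n) (g : (endOps k E).obj j) (z : Fin N → E) :
    DFunLike.coe (F := MultilinearMap k (fun _ : Fin N => E) E) ((endOps k E).comp h i f g) z =
      DFunLike.coe (F := MultilinearMap k (fun _ : Fin n => E) E) f (outerArgs h i z
        (DFunLike.coe (F := MultilinearMap k (fun _ : Fin j => E) E) g
          fun b => z (Block.incl h i b))) := rfl

theorem endOps_act_apply {n : ℕ+} (s : Equiv.Perm (Fin n)) (f : (endOps k E).obj n)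
    (z : Fin n → E) :
    DFunLike.coe (F := MultilinearMap k (fun _ : Fin n => E) E) ((endOps k E).act s f) z =
      DFunLike.coe (F := MultilinearMap k (fun _ : Fin n => E) E) f fun a => z (s.symm a) := rfl

theorem endOps_isSymmOperad : (endOps k E).IsSymmOperad where
  act_one := by
    intro n p
    exact MultilinearMap.ext fun z => rfl
  act_mul := by
    intro n s t p
    exact MultilinearMap.ext fun z => rfl
  comp_seq := by
    intro n j m A B C hA hB hC hC2 i l a ha p q r
    refine MultilinearMap.ext fun z => ?_
    have hr : (fun b => z (Block.incl hC a b)) =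
        fun b => z (Block.incl hC2 i (Block.incl hB l b)) := by
      funext b
      congr 1
      simp only [Block.incl, Fin.ext_iff]
      omega
    simp only [endOps_comp_apply]
    rw [outerArgs_outerArgs_seq hA hB hC hC2 i l a ha,
      outerArgs_incl_seq hA hB hC hC2 i l a ha, hr]
  comp_par := by
    intro n j m A B C hA hB hC hC2 i l hil a ha b hb p q r
    refine MultilinearMap.ext fun z => ?_
    simp only [endOps_comp_apply]
    rw [outerArgs_outerArgs_par hA hB hC hC2 i l hil a ha b hb,
      outerArgs_incl_left hA hB hC hC2 i l hil a ha b hb,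
      outerArgs_incl_right hA hB hC hC2 i l hil a ha b hb]
  comp_act := by
    intro n j N h i s t ρ h1 h2 p q
    refine MultilinearMap.ext fun z => ?_
    have hq : (fun b => z (Block.incl h i (t.symm b))) =
        fun b => z (ρ.symm (Block.incl h (s i) b)) := by
      funext b
      congr 1
      rw [Equiv.eq_symm_apply, h2, Equiv.apply_symm_apply]
    simp only [endOps_comp_apply, endOps_act_apply]
    rw [outerArgs_relabel h j.pos i s ρ h1, hq]

end EndOperad

/-! ### Sums over all the ways to join flags -/

namespace FGraph

variable {VC : Type u} {FC : Type v} {V W : Type} {n j N : ℕ}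

/-- The graph with the same vertices and flags as `D` whose flags are joined by `σ`. -/
def rewire (D : FGraph VC FC V) (σ : {σ : D.Flag → D.Flag // ∀ f, σ (σ f) = f}) :
    FGraph VC FC V where
  Flag := D.Flag
  finite_flag := D.finite_flag
  att := D.att
  inv := σ.1
  inv_inv := σ.2
  vcol := D.vcol
  fcol := D.fcol

instance rewire_fintype (D : FGraph VC FC V) :
    Fintype {σ : D.Flag → D.Flag // ∀ f, σ (σ f) = f} :=
  have := D.finite_flag
  Fintype.ofFinite _

/-- The condition on the graphs in the Wick sum. -/
def IsWickTerm (Adm : Set (FC × FC)) (G : FGraph VC FC V) : Prop := G.Admissible Adm ∧ G.NoTadpole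

theorem IsWickTerm.of_iso {Adm : Set (FC × FC)} {G H : FGraph VC FC V} (h : G ≈ H)
    (hG : G.IsWickTerm Adm) : H.IsWickTerm Adm := by
  obtain ⟨e, h1, h2, -, h4⟩ := h
  constructor
  · intro f hf
    obtain ⟨f, rfl⟩ := e.surjective f
    rw [h2, h4, h4]
    exact hG.1 f fun h0 => hf (by rw [h2, h0])
  · intro f hf
    obtain ⟨f, rfl⟩ := e.surjective f
    rw [h2, h1, h1]
    exact hG.2 f fun h0 => hf (by rw [h2, h0])

theorem isWickTerm_relabel {Adm : Set (FC × FC)} {G : FGraph VC FC V} (e : V ≃ W) :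
    (G.relabel e).IsWickTerm Adm ↔ G.IsWickTerm Adm :=
  ⟨fun h => ⟨h.1, fun f hf h0 => h.2 f hf (congrArg e h0)⟩,
    fun h => ⟨h.1.relabel e, h.2.relabel e⟩⟩

variable {M : Type x} [AddCommMonoid M]

/-- The sum of `Ψ` over all the admissible graphs without tadpoles obtained by joining the flags
of `D`. -/
def wickSum (Adm : Set (FC × FC)) (D : FGraph VC FC (Fin n)) (Ψ : Dgm VC FC n → M) : M :=
  ∑ σ with (D.rewire σ).IsWickTerm Adm, Ψ (Dgm.mk (D.rewire σ))

/-- Renumbering the vertices leaves the flags untouched, so both sums run over the same involutions.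
-/
theorem wickSum_relabel (Adm : Set (FC × FC)) (D : FGraph VC FC (Fin n)) (s : Equiv.Perm (Fin n))
    (Ψ : Dgm VC FC n → M) :
    wickSum Adm (D.relabel s) Ψ = wickSum Adm D fun d => Ψ (d.relabel s) := by
  unfold wickSum
  refine Finset.sum_congr (Finset.filter_congr fun σ _ => ?_) fun σ _ => rfl
  exact isWickTerm_relabel (G := D.rewire σ) s

/-- The sum depends only on the vertices and the flags, and not on how the flags are joined. -/
theorem wickSum_congr (Adm : Set (FC × FC)) {D D' : FGraph VC FC (Fin n)} (e : D.Flag ≃ D'.Flag)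
    (h1 : ∀ f, D'.att (e f) = D.att f) (h2 : D'.vcol = D.vcol)
    (h3 : ∀ f, D'.fcol (e f) = D.fcol f) (Ψ : Dgm VC FC n → M) :
    wickSum Adm D Ψ = wickSum Adm D' Ψ := by
  let t : {σ : D.Flag → D.Flag // ∀ f, σ (σ f) = f} ≃
      {σ : D'.Flag → D'.Flag // ∀ f, σ (σ f) = f} :=
    { toFun := fun σ => ⟨fun f => e (σ.1 (e.symm f)), fun f => by simp [σ.2]⟩
      invFun := fun σ => ⟨fun f => e.symm (σ.1 (e f)), fun f => by simp [σ.2]⟩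
      left_inv := fun σ => Subtype.ext (funext fun f => by simp)
      right_inv := fun σ => Subtype.ext (funext fun f => by simp) }
  have key : ∀ σ, D.rewire σ ≈ D'.rewire (t σ) := fun σ =>
    ⟨e, h1, fun f => congrArg (fun g => e (σ.1 g)) (e.symm_apply_apply f), h2, h3⟩
  refine Finset.sum_equiv t (fun σ => ?_) fun σ _ => congrArg Ψ (Quotient.sound (key σ))
  simp only [Finset.mem_filter, Finset.mem_univ, true_and]
  exact ⟨IsWickTerm.of_iso (key σ), IsWickTerm.of_iso (Setoid.symm (key σ))⟩

/-! ### Joining flags in two steps -/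

section TwoSteps

variable {Adm : Set (FC × FC)} {G : FGraph VC FC (Fin N)} {h : n + j = N + 1} {i : Fin n} {L : VC}
  {H₁ : FGraph VC FC (Fin j)} {H₂ : FGraph VC FC (Fin n)}

theorem Minor.isWickTerm_blockSub (m₁ : Minor (VertexMap.blockSub VC h i) G H₁)
    (hG : G.IsWickTerm Adm) : H₁.IsWickTerm Adm := by
  constructor
  · intro f hf
    rw [m₁.fcol, m₁.fcol, m₁.blockSub_inv f hf]
    exact hG.1 _ fun h0 => hf (m₁.inj ((m₁.blockSub_inv f hf).trans h0))
  · intro f hf h0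
    refine hG.2 (m₁.e f) (fun h0 => hf (m₁.inj ((m₁.blockSub_inv f hf).trans h0))) ?_
    rw [← m₁.blockSub_inv f hf, m₁.blockSub_att, m₁.blockSub_att, h0]

/-- A tadpole of the contraction cannot sit at the new vertex, where inner edges of the block were
removed; at any other vertex it comes from a tadpole of `G`. -/
theorem Minor.isWickTerm_blockContract (m₂ : Minor (VertexMap.blockContract h i L) G H₂)
    (hG : G.IsWickTerm Adm) : H₂.IsWickTerm Adm := by
  have hne : ∀ f, H₂.inv f ≠ f → G.inv (m₂.e f) ≠ m₂.e f := fun f hf h0 =>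
    hf (m₂.inj ((m₂.blockContract_inv f).trans h0))
  constructor
  · intro f hf
    rw [m₂.fcol, m₂.fcol, m₂.blockContract_inv f]
    exact hG.1 _ (hne f hf)
  · intro f hf h0
    have ha := m₂.att (H₂.inv f)
    rw [m₂.blockContract_inv, h0] at ha
    have hc := (m₂.range _ _ (m₂.att f)).1 ⟨f, rfl⟩ (hne f hf) ha
    exact hG.2 _ (hne f hf) ((VertexMap.blockContract h i L).inj _ _ _ ha (m₂.att f) hc)

theorem IsWickTerm.glue (m₁ : Minor (VertexMap.blockSub VC h i) G H₁)
    (m₂ : Minor (VertexMap.blockContract h i L) G H₂) (h₁ : H₁.IsWickTerm Adm)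
    (h₂ : H₂.IsWickTerm Adm) : G.IsWickTerm Adm :=
  ⟨Admissible.glue m₁ m₂ h₁.1 h₂.1, NoTadpole.glue m₁ m₂ h₁.2 h₂.2⟩

/-- The vertices of `D₁` with their flags are the vertices of `D` in the block. -/
structure InnerFlags (h : n + j = N + 1) (i : Fin n) (D : FGraph VC FC (Fin N))
    (D₁ : FGraph VC FC (Fin j)) where
  ι : D₁.Flag → D.Flag
  inj : Function.Injective ι
  range : ∀ f b, D.att f = Block.incl h i b → ∃ f₁, ι f₁ = f
  att : ∀ f, D.att (ι f) = Block.incl h i (D₁.att f)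
  fcol : ∀ f, D₁.fcol f = D.fcol (ι f)
  vcol : ∀ b, D₁.vcol b = D.vcol (Block.incl h i b)

/-- The vertices of `D₂` with their flags are the vertices of `D` outside the block, and a vertex
of colour `L` with the flags of `D₁` that `τ` leaves free. -/
structure OuterFlags (L : VC) {D : FGraph VC FC (Fin N)} {D₁ : FGraph VC FC (Fin j)}
    (I : InnerFlags h i D D₁) (τ : D₁.Flag → D₁.Flag) (D₂ : FGraph VC FC (Fin n)) where
  ε : D₂.Flag → D.Flag
  inj : Function.Injective ε
  range : ∀ f, (∃ f₂, ε f₂ = f) ↔ ∀ f₁, I.ι f₁ = f → τ f₁ = f₁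
  att : ∀ f, Block.collapse h i (D.att (ε f)) = D₂.att f
  fcol : ∀ f, D₂.fcol f = D.fcol (ε f)
  vcol_new : D₂.vcol i = L
  vcol_old : ∀ v, ¬ (i.1 ≤ v.1 ∧ v.1 < i.1 + j) → D₂.vcol (Block.collapse h i v) = D.vcol v

variable {D : FGraph VC FC (Fin N)} {D₁ : FGraph VC FC (Fin j)} {D₂ : FGraph VC FC (Fin n)}

/-- `τ` is the restriction of `σ` to the flags of the block. -/
def InnerFlags.Restricts (I : InnerFlags h i D D₁) (σ : D.Flag → D.Flag)
    (τ : D₁.Flag → D₁.Flag) : Prop :=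
  ∀ f, I.ι (τ f) = if ∃ b, D.att (σ (I.ι f)) = Block.incl h i b then σ (I.ι f) else I.ι f

theorem InnerFlags.exists_restriction (I : InnerFlags h i D D₁)
    (σ : {σ : D.Flag → D.Flag // ∀ f, σ (σ f) = f}) :
    ∃ τ : {τ : D₁.Flag → D₁.Flag // ∀ f, τ (τ f) = f}, I.Restricts σ.1 τ.1 := by
  have : ∀ f, ∃ g, I.ι g =
      if ∃ b, D.att (σ.1 (I.ι f)) = Block.incl h i b then σ.1 (I.ι f) else I.ι f := by
    intro f
    split_ifs with h0
    · exact I.range _ _ h0.choose_spec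
    · exact ⟨f, rfl⟩
  choose τ hτ using this
  refine ⟨⟨τ, fun f => ?_⟩, hτ⟩
  by_cases h0 : ∃ b, D.att (σ.1 (I.ι f)) = Block.incl h i b
  · have h1 := hτ f
    rw [if_pos h0] at h1
    apply I.inj
    rw [hτ, h1, σ.2, if_pos ⟨_, I.att f⟩]
  · have h1 := hτ f
    rw [if_neg h0] at h1
    rw [I.inj h1, I.inj h1]

theorem InnerFlags.Restricts.unique {I : InnerFlags h i D D₁} {σ : D.Flag → D.Flag}
    {τ τ' : D₁.Flag → D₁.Flag} (h1 : I.Restricts σ τ) (h2 : I.Restricts σ τ') : τ = τ' :=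
  funext fun f => I.inj ((h1 f).trans (h2 f).symm)

theorem InnerFlags.Restricts.apply_of_ne {I : InnerFlags h i D D₁} {σ : D.Flag → D.Flag}
    {τ : D₁.Flag → D₁.Flag} (h1 : I.Restricts σ τ) (f : D₁.Flag) (hf : τ f ≠ f) :
    σ (I.ι f) = I.ι (τ f) := by
  have h2 := h1 f
  split_ifs at h2
  · exact h2.symm
  · exact absurd (I.inj h2) hf

/-- The restriction to the block gives the subgraph. -/
def InnerFlags.Restricts.minor {I : InnerFlags h i D D₁}
    {σ : {σ : D.Flag → D.Flag // ∀ f, σ (σ f) = f}}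
    {τ : {τ : D₁.Flag → D₁.Flag // ∀ f, τ (τ f) = f}} (hr : I.Restricts σ.1 τ.1) :
    Minor (VertexMap.blockSub VC h i) (D.rewire σ) (D₁.rewire τ) where
  e := I.ι
  inj := I.inj
  att := fun f => (congrArg _ (I.att f)).trans (VertexMap.blockSub_incl h i VC _)
  inv := by
    intro f
    refine (hr f).trans ?_
    by_cases h0 : ∃ b, D.att (σ.1 (I.ι f)) = Block.incl h i b
    · rw [if_pos h0]
      refine (if_neg ?_).symm
      obtain ⟨b, hb⟩ := h0
      intro h1
      have := (congrArg _ hb).symm.trans h1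
      rw [VertexMap.blockSub_incl] at this
      cases this
    · rw [if_neg h0]
      refine (if_pos ?_).symm
      rw [Option.eq_none_iff_forall_ne_some]
      intro b hb
      exact h0 ⟨b, Fin.ext ((VertexMap.blockSub_eq_some h i VC _ b).1 hb)⟩
  range := by
    intro g a ha
    exact ⟨fun _ _ _ => rfl, fun _ =>
      I.range g a (Fin.ext ((VertexMap.blockSub_eq_some h i VC _ a).1 ha))⟩
  fcol := I.fcol
  vcol_new := by simp [VertexMap.blockSub]
  vcol_old := by
    intro v a ha _
    obtain rfl : v = Block.incl h i a := Fin.ext ((VertexMap.blockSub_eq_some h i VC v a).1 ha)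
    exact I.vcol a

/-- If `σ` restricts to `τ` on the block, then its restriction to the other flags gives the
contraction. -/
def OuterFlags.minor (hj : 0 < j) {I : InnerFlags h i D D₁}
    {σ : {σ : D.Flag → D.Flag // ∀ f, σ (σ f) = f}} {τ : D₁.Flag → D₁.Flag}
    (O : OuterFlags L I τ D₂) {σ' : {σ' : D₂.Flag → D₂.Flag // ∀ f, σ' (σ' f) = f}}
    (hr : I.Restricts σ.1 τ) (hσ : ∀ f, O.ε (σ'.1 f) = σ.1 (O.ε f)) :
    Minor (VertexMap.blockContract h i L) (D.rewire σ) (D₂.rewire σ') where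
  e := O.ε
  inj := O.inj
  att := fun f => congrArg some (O.att f)
  inv := fun f => (hσ f).trans (if_neg (by simp [VertexMap.blockContract])).symm
  range := by
    intro g a ha
    refine (O.range g).trans ?_
    change _ ↔ (σ.1 g ≠ g → some (Block.collapse h i (D.att (σ.1 g))) = some a →
      (if a = i then some L else none) = none)
    have ha' : Block.collapse h i (D.att g) = a := Option.some_injective _ ha
    -- A block flag that `τ` leaves fixed is joined by `σ` either to nothing or to a flag outside
    -- the block, by `hr`. One that `τ` moves lies on an edge inside the block, which the
    -- contraction removes.
    constructor
    · intro h1 h2 h3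
      refine if_neg ?_
      rintro rfl
      obtain ⟨b, hb⟩ := Block.exists_incl h a _ ((Block.collapse_eq_iff h a hj _).1 ha')
      obtain ⟨f, rfl⟩ := I.range g b hb.symm
      obtain ⟨b', hb'⟩ := Block.exists_incl h a _
        ((Block.collapse_eq_iff h a hj _).1 (Option.some_injective _ h3))
      have h4 := hr f
      rw [h1 f rfl, if_pos ⟨b', hb'.symm⟩] at h4
      exact h2 h4.symm
    · rintro h1 f rfl
      by_contra hf
      have h2 := hr.apply_of_ne f hf
      rw [I.att, Block.collapse_incl] at ha'
      have := h1 (fun h3 => hf (I.inj (h2.symm.trans h3))) (by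
        rw [h2, I.att, Block.collapse_incl, ha'])
      simp [← ha'] at this
  fcol := O.fcol
  vcol_new := by
    intro a L' ha
    simp only [VertexMap.blockContract] at ha
    split_ifs at ha with h1
    obtain rfl := Option.some_injective _ ha
    rw [h1]
    exact O.vcol_new
  vcol_old := by
    intro v a ha hc
    obtain rfl := Option.some_injective _ ha
    refine O.vcol_old v fun hv => ?_
    simp [VertexMap.blockContract, (Block.collapse_eq_iff h i hj v).2 hv] at hc

variable {I : InnerFlags h i D D₁} {τ : {τ : D₁.Flag → D₁.Flag // ∀ f, τ (τ f) = f}}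

theorem OuterFlags.cases (O : OuterFlags L I τ.1 D₂) (f : D.Flag) :
    (∃ f₂, O.ε f₂ = f) ∨ ∃ f₁, I.ι f₁ = f ∧ τ.1 f₁ ≠ f₁ := by
  rw [O.range]
  by_contra! h0
  obtain ⟨⟨f₁, h1, h2⟩, h3⟩ := h0
  exact h2 (h3 f₁ h1)

/-- Joinings of the flags of the block and of the flags outside add up to a joining of all flags. -/
theorem OuterFlags.exists_join (O : OuterFlags L I τ.1 D₂)
    (σ' : {σ' : D₂.Flag → D₂.Flag // ∀ f, σ' (σ' f) = f}) :
    ∃ σ : {σ : D.Flag → D.Flag // ∀ f, σ (σ f) = f},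
      (∀ f, O.ε (σ'.1 f) = σ.1 (O.ε f)) ∧ ∀ f, τ.1 f ≠ f → σ.1 (I.ι f) = I.ι (τ.1 f) := by
  -- Free and outer flags follow `σ'`, the flags moved by `τ` follow `τ`. The last value is never
  -- used, by `O.cases`.
  let σ : D.Flag → D.Flag := fun f =>
    if h₂ : ∃ f₂, O.ε f₂ = f then O.ε (σ'.1 h₂.choose)
    else if h₁ : ∃ f₁, I.ι f₁ = f then I.ι (τ.1 h₁.choose) else f
  have h2 : ∀ f, σ (O.ε f) = O.ε (σ'.1 f) := by
    intro f
    have h0 : ∃ f₂, O.ε f₂ = O.ε f := ⟨f, rfl⟩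
    exact (dif_pos h0).trans (by rw [O.inj h0.choose_spec])
  have h1 : ∀ f, τ.1 f ≠ f → σ (I.ι f) = I.ι (τ.1 f) := by
    intro f hf
    have h0 : ∃ f₁, I.ι f₁ = I.ι f := ⟨f, rfl⟩
    refine (dif_neg fun h0 => hf ((O.range _).1 h0 f rfl)).trans ((dif_pos h0).trans ?_)
    rw [I.inj h0.choose_spec]
  refine ⟨⟨σ, fun f => ?_⟩, fun f => (h2 f).symm, h1⟩
  rcases O.cases f with ⟨f₂, rfl⟩ | ⟨f₁, rfl, hf⟩
  · rw [h2, h2, σ'.2]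
  · rw [h1 f₁ hf, h1 _ (by rw [τ.2]; exact hf.symm), τ.2]

/-- If `σ'` joined two flags of the block left free by `τ`, the restriction of `σ` would have more
edges than `τ`. Such an edge is a tadpole at the new vertex of `D₂`, which `hσ'` excludes. -/
theorem OuterFlags.restricts_of_join (O : OuterFlags L I τ.1 D₂)
    {σ' : {σ' : D₂.Flag → D₂.Flag // ∀ f, σ' (σ' f) = f}}
    {σ : {σ : D.Flag → D.Flag // ∀ f, σ (σ f) = f}} (hσ' : (D₂.rewire σ').NoTadpole)
    (h2 : ∀ f, O.ε (σ'.1 f) = σ.1 (O.ε f)) (h1 : ∀ f, τ.1 f ≠ f → σ.1 (I.ι f) = I.ι (τ.1 f)) :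
    I.Restricts σ.1 τ.1 := by
  intro f
  by_cases hf : τ.1 f = f
  · obtain ⟨f₂, hf₂⟩ := (O.range (I.ι f)).2 fun f₁ h0 => by rw [I.inj h0, hf]
    rw [hf]
    split_ifs with h0
    · obtain ⟨b, hb⟩ := h0
      have h3 : σ'.1 f₂ = f₂ := by
        by_contra h3
        apply hσ' f₂ h3
        change D₂.att (σ'.1 f₂) = D₂.att f₂
        rw [← O.att, ← O.att, h2, hf₂, hb, I.att, Block.collapse_incl, Block.collapse_incl]
      rw [← hf₂, ← h2, h3]
    · rfl
  · rw [h1 f hf, if_pos ⟨_, I.att _⟩]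

/-- On flags moved by `τ` the involution `σ` agrees with `τ`, hence preserves that set of flags and
also its complement, the range of `ε`. -/
theorem OuterFlags.exists_split (O : OuterFlags L I τ.1 D₂)
    {σ : {σ : D.Flag → D.Flag // ∀ f, σ (σ f) = f}} (hr : I.Restricts σ.1 τ.1) :
    ∃ σ' : {σ' : D₂.Flag → D₂.Flag // ∀ f, σ' (σ' f) = f},
      ∀ f, O.ε (σ'.1 f) = σ.1 (O.ε f) := by
  have : ∀ f, ∃ g, O.ε g = σ.1 (O.ε f) := by
    intro f
    rw [O.range]
    intro f₁ h0
    by_contra hf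
    have h1 := hr.apply_of_ne f₁ hf
    rw [h0, σ.2] at h1
    have h2 := (O.range (O.ε f)).1 ⟨f, rfl⟩ (τ.1 f₁) h1.symm
    rw [τ.2] at h2
    exact hf h2.symm
  choose σ' hσ' using this
  exact ⟨⟨σ', fun f => O.inj (by rw [hσ', hσ', σ.2])⟩, hσ'⟩

theorem OuterFlags.join_unique (O : OuterFlags L I τ.1 D₂)
    {σ' : {σ' : D₂.Flag → D₂.Flag // ∀ f, σ' (σ' f) = f}}
    {σ ρ : {σ : D.Flag → D.Flag // ∀ f, σ (σ f) = f}}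
    (h2 : ∀ f, O.ε (σ'.1 f) = σ.1 (O.ε f)) (h1 : ∀ f, τ.1 f ≠ f → σ.1 (I.ι f) = I.ι (τ.1 f))
    (g2 : ∀ f, O.ε (σ'.1 f) = ρ.1 (O.ε f)) (g1 : ∀ f, τ.1 f ≠ f → ρ.1 (I.ι f) = I.ι (τ.1 f)) :
    σ = ρ := by
  refine Subtype.ext (funext fun f => ?_)
  rcases O.cases f with ⟨f₂, rfl⟩ | ⟨f₁, rfl, hf⟩
  · rw [← h2, g2]
  · rw [h1 f₁ hf, g1 f₁ hf]

/-- To join all the flags is to join first the flags of the block, and then the flags outside the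
block and those of the block that were left free. -/
theorem wickSum_block (Adm : Set (FC × FC)) (hj : 0 < j) (I : InnerFlags h i D D₁)
    (D₂ : {τ : D₁.Flag → D₁.Flag // ∀ f, τ (τ f) = f} → FGraph VC FC (Fin n))
    (O : ∀ τ, OuterFlags L I τ.1 (D₂ τ)) (Ψ : Dgm VC FC j → Dgm VC FC n → M) :
    wickSum Adm D (fun d => Ψ (d.blockSub h i) (d.blockContract h i L)) =
      ∑ τ with (D₁.rewire τ).IsWickTerm Adm,
        wickSum Adm (D₂ τ) (Ψ (Dgm.mk (D₁.rewire τ))) := by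
  choose res hres using I.exists_restriction
  unfold wickSum
  -- The joinings of `D` are grouped by their restriction to the block.
  rw [← Finset.sum_fiberwise_of_maps_to (g := res)
    (t := {τ | (D₁.rewire τ).IsWickTerm Adm}) (fun σ hσ => by
      simp only [Finset.mem_filter, Finset.mem_univ, true_and] at hσ ⊢
      exact (hres σ).minor.isWickTerm_blockSub hσ)]
  refine Finset.sum_congr rfl fun τ hτ => ?_
  simp only [Finset.mem_filter, Finset.mem_univ, true_and] at hτ
  choose join hjoin₂ hjoin₁ using (O τ).exists_join
  have hrestr : ∀ σ', ((D₂ τ).rewire σ').IsWickTerm Adm → I.Restricts (join σ').1 τ.1 :=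
    fun σ' hσ' => (O τ).restricts_of_join hσ'.2 (hjoin₂ σ') (hjoin₁ σ')
  symm
  -- For fixed `τ`, joining with `τ` is a bijection from the outer joinings onto the fibre over `τ`;
  -- its inverse is given by `exists_split`.
  refine Finset.sum_bij (fun σ' _ => join σ') (fun σ' hσ' => ?_) (fun σ' _ σ'' _ he => ?_)
    (fun σ hσ => ?_) fun σ' hσ' => ?_
  · simp only [Finset.mem_filter, Finset.mem_univ, true_and] at hσ' ⊢
    have hr := hrestr σ' hσ'
    exact ⟨IsWickTerm.glue hr.minor ((O τ).minor hj hr (hjoin₂ σ')) hτ hσ',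
      Subtype.ext ((hres _).unique hr)⟩
  · refine Subtype.ext (funext fun f => (O τ).inj ?_)
    rw [hjoin₂, hjoin₂, he]
  · simp only [Finset.mem_filter, Finset.mem_univ, true_and] at hσ
    obtain ⟨hσ, rfl⟩ := hσ
    obtain ⟨σ', hσ'⟩ := (O (res σ)).exists_split (hres σ)
    refine ⟨σ', ?_, (O (res σ)).join_unique (hjoin₂ σ') (hjoin₁ σ') hσ' (hres σ).apply_of_ne⟩
    simp only [Finset.mem_filter, Finset.mem_univ, true_and]
    exact ((O (res σ)).minor hj (hres σ) hσ').isWickTerm_blockContract hσ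
  · simp only [Finset.mem_filter, Finset.mem_univ, true_and] at hσ'
    have hr := hrestr σ' hσ'
    congr 1
    · exact Quotient.sound (hr.minor.iso (blockSubMinor _ h i))
    · exact Quotient.sound (((O τ).minor hj hr (hjoin₂ σ')).iso (blockContractMinor _ h i L))

end TwoSteps

end FGraph

/-! ### The Wick operator and partial compositions -/

section Wick

open FGraph

variable {VC : Type u} {FC : Type v} {n j N : ℕ} {M : Type x} [AddCommMonoid M]

/-- The vertices `G 0, …, G (n-1)` with all their flags free. -/
def bouquet (G : Fin n → FGraph VC FC (Fin 1)) : FGraph VC FC (Fin n) :=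
  connect G ⟨id, fun _ => rfl⟩

theorem wickSum_bouquet_congr (Adm : Set (FC × FC)) {G G' : Fin n → FGraph VC FC (Fin 1)}
    (hG : ∀ a, G a ≈ G' a) (Ψ : Dgm VC FC n → M) :
    wickSum Adm (bouquet G) Ψ = wickSum Adm (bouquet G') Ψ := by
  choose e h1 h2 h3 h4 using hG
  exact wickSum_congr Adm (Equiv.sigmaCongrRight e) (fun _ => rfl)
    (funext fun a => congrFun (h3 a) 0) (fun f : Σ a, (G a).Flag => h4 f.1 f.2) Ψ

/-- The bouquet that has `G (s⁻¹ a)` at the place `a` is the renumbering by `s` of the bouquet of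
`G`, up to a bijection of flags. -/
theorem wickSum_bouquet_perm (Adm : Set (FC × FC)) (G : Fin n → FGraph VC FC (Fin 1))
    (s : Equiv.Perm (Fin n)) (Ψ : Dgm VC FC n → M) :
    wickSum Adm (bouquet fun a => G (s.symm a)) Ψ =
      wickSum Adm (bouquet G) fun d => Ψ (d.relabel s) := by
  rw [← wickSum_relabel]
  exact wickSum_congr Adm (D := bouquet fun a => G (s.symm a)) (D' := (bouquet G).relabel s)
    (Equiv.sigmaCongrLeft (β := fun a => (G a).Flag) s.symm)
    (fun f : Σ a, (G (s.symm a)).Flag => s.apply_symm_apply f.1) rfl (fun _ => rfl) Ψ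

/-- The flags of the vertices in a block. -/
def innerFlags (h : n + j = N + 1) (i : Fin n) (G : Fin N → FGraph VC FC (Fin 1)) :
    InnerFlags h i (bouquet G) (bouquet fun b => G (Block.incl h i b)) where
  ι := fun f => ⟨Block.incl h i f.1, f.2⟩
  inj := by
    rintro ⟨b, f⟩ ⟨b', f'⟩ he
    have h1 : Block.incl h i b = Block.incl h i b' := congrArg Sigma.fst he
    obtain rfl : b = b' := Option.some_injective _ (by
      rw [← VertexMap.blockSub_incl h i VC, h1, VertexMap.blockSub_incl])
    cases he
    rfl
  range := by
    rintro ⟨a, f⟩ b rfl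
    exact ⟨⟨b, f⟩, rfl⟩
  att := fun _ => rfl
  fcol := fun _ => rfl
  vcol := fun _ => rfl

/-- The one-vertex graph of colour `L` that arises by joining the flags of `G 0, …, G (n-1)`
by `τ` and contracting everything. -/
def contractConnect (G : Fin j → FGraph VC FC (Fin 1))
    (τ : {τ : (Σ a, (G a).Flag) → (Σ a, (G a).Flag) // ∀ f, τ (τ f) = f}) (L : VC) :
    FGraph VC FC (Fin 1) :=
  ((connect G τ).contract Set.univ L).relabel (Dgm.pointEquiv j)

/-- A flag of the new vertex or of a vertex outside the block, as a flag of the whole bouquet. -/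
def outerFlag (h : n + j = N + 1) (i : Fin n) (G : Fin N → FGraph VC FC (Fin 1))
    (τ : {τ : (Σ b : Fin j, (G (Block.incl h i b)).Flag) → (Σ b, (G (Block.incl h i b)).Flag) //
      ∀ f, τ (τ f) = f}) (L : VC) :
    (Σ o : Option ((Block.set j N i)ᶜ : Set (Fin N)),
      (o.elim (contractConnect (fun b => G (Block.incl h i b)) τ L) fun a => G a.1).Flag) →
      Σ a, (G a).Flag
  | ⟨none, f⟩ => (innerFlags h i G).ι f.1
  | ⟨some a, f⟩ => ⟨a.1, f⟩

variable (h : n + j = N + 1) (i : Fin n) (G : Fin N → FGraph VC FC (Fin 1))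
  (τ : {τ : (Σ b : Fin j, (G (Block.incl h i b)).Flag) → (Σ b, (G (Block.incl h i b)).Flag) //
      ∀ f, τ (τ f) = f}) (L : VC)

theorem outerFlag_att (x) :
    Block.collapse h i (outerFlag h i G τ L x).1 = Block.contractEquiv h i x.1 := by
  obtain ⟨_ | a, f⟩ := x
  · exact Block.collapse_incl h i _
  · rfl

theorem outerFlag_injective : Function.Injective (outerFlag h i G τ L) := by
  intro x y he
  have h1 : x.1 = y.1 := (Block.contractEquiv h i).injective (by
    rw [← outerFlag_att, ← outerFlag_att, he])
  obtain ⟨o, f⟩ := x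
  obtain ⟨o', f'⟩ := y
  obtain rfl : o = o' := h1
  rcases o with _ | a
  · have := Subtype.ext ((innerFlags h i G).inj he)
    rw [this]
  · cases he
    rfl

theorem outerFlag_range (f : Σ a, (G a).Flag) :
    (∃ x, outerFlag h i G τ L x = f) ↔ ∀ f₁, (innerFlags h i G).ι f₁ = f → τ.1 f₁ = f₁ := by
  constructor
  · rintro ⟨⟨_ | a, f⟩, rfl⟩ f₁ he
    · obtain rfl := (innerFlags h i G).inj he
      -- All vertices of the inner graph are contracted, so its surviving flags are precisely those
      -- fixed by `τ`.
      exact f.2 ⟨trivial, trivial⟩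
    · refine absurd ?_ a.2
      have h1 : Block.incl h i f₁.1 = a.1 := congrArg Sigma.fst he
      rw [← h1]
      exact ((Block.subEquiv h i).symm f₁.1).2
  · intro hf
    by_cases ha : f.1 ∈ Block.set j N i
    · obtain ⟨b, hb⟩ := Block.exists_incl h i f.1 ha
      obtain ⟨f₁, rfl⟩ := (innerFlags h i G).range f b hb.symm
      exact ⟨⟨none, ⟨f₁, fun _ => hf f₁ rfl⟩⟩, rfl⟩
    · exact ⟨⟨some ⟨f.1, ha⟩, f.2⟩, rfl⟩

theorem outerFlag_fcol (x) :
    (x.1.elim (contractConnect (fun b => G (Block.incl h i b)) τ L) fun a => G a.1).fcol x.2 =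
      (bouquet G).fcol (outerFlag h i G τ L x) := by
  obtain ⟨_ | a, f⟩ := x <;> rfl

/-- The flags that are left after joining the flags of the block. -/
def outerFlags : OuterFlags L (innerFlags h i G) τ.1
    (bouquet (outerArgs h i G (contractConnect (fun b => G (Block.incl h i b)) τ L))) where
  -- `outerArgs` eliminates the same `Option`, so the flag types agree by definition and no
  -- transport along an equality of positions is needed.
  ε := fun f => outerFlag h i G τ L ⟨(Block.contractEquiv h i).symm f.1, f.2⟩
  inj := by
    have := (outerFlag_injective h i G τ L).comp (Equiv.sigmaCongrLeft
      (β := fun o : Option ((Block.set j N i)ᶜ : Set (Fin N)) => (o.elim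
        (contractConnect (fun b => G (Block.incl h i b)) τ L) fun a => G a.1).Flag)
      (Block.contractEquiv h i).symm).injective
    exact this
  range := by
    intro f
    refine Iff.trans ?_ (outerFlag_range h i G τ L f)
    exact (Function.Surjective.exists (p := fun x => outerFlag h i G τ L x = f) (Equiv.sigmaCongrLeft
      (β := fun o : Option ((Block.set j N i)ᶜ : Set (Fin N)) => (o.elim
        (contractConnect (fun b => G (Block.incl h i b)) τ L) fun a => G a.1).Flag)
      (Block.contractEquiv h i).symm).surjective).symm
  att := fun f => (outerFlag_att h i G τ L _).trans (Equiv.apply_symm_apply _ _)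
  fcol := fun f => outerFlag_fcol h i G τ L ⟨(Block.contractEquiv h i).symm f.1, f.2⟩
  vcol_new := by
    change (outerArgs h i G _ i).vcol 0 = L
    rw [outerArgs_self]
    rfl
  vcol_old := by
    intro v hv
    change (outerArgs h i G _ _).vcol 0 = (G v).vcol 0
    rw [outerArgs_collapse h i G _ v hv]

variable {k : Type w} [CommRing k]

theorem outerArgs_equiv {C C' : FGraph VC FC (Fin 1)} (hC : C ≈ C') (b : Fin n) :
    outerArgs h i G C b ≈ outerArgs h i G C' b := by
  unfold outerArgs
  rcases (Block.contractEquiv h i).symm b with _ | a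
  · exact hC
  · exact Setoid.refl _

/-- The passage to `wickSum`, in which an arbitrary function of the diagram can be summed. -/
theorem hatMap_wick (Adm : Set (FC × FC)) [Fintype VC] (Q : ContractionMap k VC FC n)
    (G : Fin n → FGraph VC FC (Fin 1)) :
    hatMap Q (wick k Adm G) =
      wickSum Adm (bouquet G) fun d => ∑ L : VC, Finsupp.single (d.contractAll L) (Q d L) := by
  have : wick k Adm G = wickSum Adm (bouquet G) fun d => Finsupp.single d 1 :=
    Finset.sum_congr (Finset.ext fun σ =>
      ⟨fun h => Finset.mem_filter.2 ⟨Finset.mem_univ _, (Finset.mem_filter.1 h).2⟩,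
        fun h => Finset.mem_filter.2 ⟨Finset.mem_univ _, (Finset.mem_filter.1 h).2⟩⟩) fun _ _ => rfl
  simp only [this, wickSum, map_sum, hatMap, Finsupp.linearCombination_single, one_smul]

theorem hatMap_wick_congr (Adm : Set (FC × FC)) [Fintype VC] (Q : ContractionMap k VC FC n)
    {G G' : Fin n → FGraph VC FC (Fin 1)} (hG : ∀ a, G a ≈ G' a) :
    hatMap Q (wick k Adm G) = hatMap Q (wick k Adm G') := by
  rw [hatMap_wick, hatMap_wick, wickSum_bouquet_congr Adm hG]

theorem hatMap_wick_act (Adm : Set (FC × FC)) [Fintype VC] (Q : ContractionMap k VC FC n)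
    (G : Fin n → FGraph VC FC (Fin 1)) (s : Equiv.Perm (Fin n)) :
    hatMap (fun d => Q (d.relabel s)) (wick k Adm G) =
      hatMap Q (wick k Adm fun a => G (s.symm a)) := by
  rw [hatMap_wick, hatMap_wick, wickSum_bouquet_perm]
  simp only [Dgm.relabel_contractAll]

/-- The total contraction of the Wick sum, for a partial composition. -/
theorem hatMap_wick_comp (Adm : Set (FC × FC)) [Fintype VC] (hj : 0 < j)
    (P : ContractionMap k VC FC n) (Q : ContractionMap k VC FC j) :
    hatMap (fun d K => ∑ L : VC, Q (d.blockSub h i) L * P (d.blockContract h i L) K)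
        (wick k Adm G) =
      wickSum Adm (bouquet fun b => G (Block.incl h i b)) fun d => ∑ L : VC, Q d L •
        hatMap P (wick k Adm (outerArgs h i G (d.contractAll L).out)) := by
  -- For each colour `L` of the new vertex the summand depends only on the subgraph and the
  -- contraction, as `wickSum_block` requires: the total contraction of `d` is that of its block
  -- contraction.
  let Ψ : VC → Dgm VC FC j → Dgm VC FC n → Dgm VC FC 1 →₀ k := fun L d₁ d₂ =>
    Q d₁ L • ∑ K : VC, Finsupp.single (d₂.contractAll K) (P d₂ K)
  have h1 : hatMap (fun d K => ∑ L : VC, Q (d.blockSub h i) L * P (d.blockContract h i L) K)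
      (wick k Adm G) = ∑ L : VC, wickSum Adm (bouquet G) fun d =>
        Ψ L (d.blockSub h i) (d.blockContract h i L) := by
    rw [hatMap_wick]
    unfold wickSum
    refine Eq.trans (Finset.sum_congr rfl fun σ _ => ?_) Finset.sum_comm
    simp only [Ψ, Dgm.blockContract_contractAll, Finset.smul_sum, Finsupp.smul_single, smul_eq_mul,
      Finsupp.single_finsetSum]
    exact Finset.sum_comm
  have h2 : ∀ L, (wickSum Adm (bouquet G) fun d =>
      Ψ L (d.blockSub h i) (d.blockContract h i L)) =
      wickSum Adm (bouquet fun b => G (Block.incl h i b)) fun d => Q d L •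
        hatMap P (wick k Adm (outerArgs h i G (d.contractAll L).out)) := by
    intro L
    rw [wickSum_block Adm hj (innerFlags h i G) _ (fun τ => outerFlags h i G τ L)]
    refine Finset.sum_congr rfl fun τ _ => ?_
    -- The chosen representative of the contracted vertex may be replaced by the explicit
    -- `contractConnect`.
    have e : hatMap P (wick k Adm (outerArgs h i G (Dgm.contractAll L
        (Dgm.mk (connect (fun b => G (Block.incl h i b)) τ))).out)) = hatMap P (wick k Adm
          (outerArgs h i G (contractConnect (fun b => G (Block.incl h i b)) τ L))) :=
      hatMap_wick_congr Adm P (outerArgs_equiv h i G (Quotient.exact (Quotient.out_eq _)))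
    refine Eq.trans ?_ (congrArg (fun x =>
      Q (Dgm.mk (connect (fun b => G (Block.incl h i b)) τ)) L • x) e).symm
    rw [hatMap_wick]
    unfold wickSum
    exact Finset.smul_sum.symm
  rw [h1, Finset.sum_congr rfl fun L _ => h2 L]
  unfold wickSum
  exact Finset.sum_comm

end Wick

/-! ### Multilinear maps on free modules -/

section Free

variable (k : Type w) [CommRing k] {T : Type u} {E : Type x} [AddCommGroup E] [Module k E] {n : ℕ}

/-- The multilinear map on a free module with prescribed values on the basis. -/
def freeMultilinear : ((Fin n → T) → E) →ₗ[k] MultilinearMap k (fun _ : Fin n => T →₀ k) E :=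
  (MultilinearMap.compLinearMapₗ fun _ => (finsuppLequivDFinsupp (ι := T) (M := k) k).toLinearMap) ∘ₗ
    (MultilinearMap.fromDFinsuppEquiv (fun _ : Fin n => T) k
      (M := fun _ _ => k) (N := E)).toLinearMap ∘ₗ
    LinearMap.pi fun v => (MultilinearMap.piRingEquiv (R := k) (ι := Fin n) (M₂ := E)).toLinearMap ∘ₗ
      LinearMap.proj v

theorem freeMultilinear_single (F : (Fin n → T) → E) (v : Fin n → T) :
    freeMultilinear k F (fun a => Finsupp.single (v a) 1) = F v := by
  simp [freeMultilinear, MultilinearMap.piRingEquiv]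

variable {k}

theorem MultilinearMap.ext_single {f g : MultilinearMap k (fun _ : Fin n => T →₀ k) E}
    (h : ∀ v : Fin n → T, f (fun a => Finsupp.single (v a) 1) =
      g fun a => Finsupp.single (v a) 1) : f = g :=
  Module.Basis.ext_multilinear (fun _ => Finsupp.basisSingleOne) fun v => by simpa using h v

end Free

/-! ### The morphism given by the Wick operator -/

section Morphism

theorem exists_representatives {VC : Type u} {FC : Type v} {n : ℕ} (T : Set (Dgm VC FC 1)) (v : Fin n → T) :
    ∃ G : Fin n → FGraph VC FC (Fin 1), ∀ a, Dgm.mk (G a) = v a :=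
  ⟨fun a => (v a).1.out, fun _ => Quotient.out_eq _⟩

variable {k : Type w} [CommRing k] {VC : Type u} [Fintype VC] {FC : Type v} {n : ℕ}

theorem hatMap_single (Q : ContractionMap k VC FC n) (d : Dgm VC FC n) (c : k) :
    hatMap Q (Finsupp.single d c) =
      c • ∑ L : VC, Finsupp.single (d.contractAll L) (Q d L) := by
  simp [hatMap]

theorem hatMap_add (Q Q' : ContractionMap k VC FC n) : hatMap (Q + Q') = hatMap Q + hatMap Q' := by
  refine Finsupp.lhom_ext fun d c => ?_
  simp only [LinearMap.add_apply, hatMap_single, Pi.add_apply, Finsupp.single_add,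
    Finset.sum_add_distrib, smul_add]

theorem hatMap_smul (c : k) (Q : ContractionMap k VC FC n) : hatMap (c • Q) = c • hatMap Q := by
  refine Finsupp.lhom_ext fun d c' => ?_
  simp only [LinearMap.smul_apply, hatMap_single, Pi.smul_apply, ← Finsupp.smul_single,
    ← Finset.smul_sum]
  rw [smul_comm]

/-- The total contraction takes values in the free module on the types of vertices. -/
theorem mapDomain_subtypeDomain_hatMap {Adm : Set (FC × FC)} {T : Set (Dgm VC FC 1)}
    (Q : theorySub k Adm T n) (x : Dgm VC FC n →₀ k) :
    Finsupp.mapDomain Subtype.val (Finsupp.subtypeDomain (· ∈ T) (hatMap Q.1 x)) =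
      hatMap Q.1 x := by
  have hQ := mem_theorySub.1 Q.2
  refine LinearMap.congr_fun (f := (Finsupp.lmapDomain k k Subtype.val) ∘ₗ
    Finsupp.lsubtypeDomain T ∘ₗ hatMap Q.1) (Finsupp.lhom_ext fun d c => ?_) x
  simp only [LinearMap.comp_apply, hatMap_single, map_smul, map_sum]
  congr 1
  refine Finset.sum_congr rfl fun L _ => ?_
  by_cases h : Q.1 d L = 0
  · simp [h]
  · have hT := (hQ d L h).2.2.2
    have : Finsupp.lsubtypeDomain (R := k) T (Finsupp.single (d.contractAll L) (Q.1 d L)) =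
        Finsupp.single ⟨d.contractAll L, hT⟩ (Q.1 d L) := by
      ext t
      simp [Finsupp.lsubtypeDomain, Finsupp.single_apply, Subtype.ext_iff]
    rw [this]
    simp

variable (k) in
/-- The multilinear maps `R_n(Q)`. -/
def wickMap (Adm : Set (FC × FC)) (T : Set (Dgm VC FC 1)) (n : ℕ+) :
    theorySub k Adm T n →ₗ[k] MultilinearMap k (fun _ : Fin n => T →₀ k) (T →₀ k) :=
  freeMultilinear k ∘ₗ
    -- The truncation to `T` loses nothing, by `mapDomain_subtypeDomain_hatMap`.
    { toFun := fun Q v => Finsupp.lsubtypeDomain (R := k) T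
        (hatMap Q.1 (wick k Adm fun a => (v a).1.out))
      map_add' := fun Q Q' => funext fun v => by
        simp [hatMap_add]
      map_smul' := fun c Q => funext fun v => by
        simp [hatMap_smul] }

theorem wickMap_isWickContraction (Adm : Set (FC × FC)) (T : Set (Dgm VC FC 1)) :
    IsWickContraction k Adm T (wickMap k Adm T) := by
  intro n Q v G hG
  rw [wickMap, LinearMap.comp_apply, freeMultilinear_single]
  refine (mapDomain_subtypeDomain_hatMap Q _).trans (hatMap_wick_congr Adm Q.1 fun a => ?_)
  exact Quotient.exact ((Quotient.out_eq _).trans (hG a).symm)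

namespace IsWickContraction

variable {Adm : Set (FC × FC)} {T : Set (Dgm VC FC 1)}
  {R R' : ∀ n : ℕ+, theorySub k Adm T n →ₗ[k] MultilinearMap k (fun _ : Fin n => T →₀ k) (T →₀ k)}

theorem eq (hR : IsWickContraction k Adm T R) (hR' : IsWickContraction k Adm T R') : R = R' := by
  funext n
  refine LinearMap.ext fun Q => MultilinearMap.ext_single fun v => ?_
  obtain ⟨G, hG⟩ := exists_representatives T v
  exact Finsupp.mapDomain_injective Subtype.val_injective
    ((hR n Q v G hG).trans (hR' n Q v G hG).symm)

/-- The value at basis vectors outside the block and an arbitrary vector at the position of the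
block. -/
theorem apply_outerArgs (hR : IsWickContraction k Adm T R) {n : ℕ+} {j N : ℕ} (h : n + j = N + 1)
    (i : Fin n) (P : theorySub k Adm T n) (v : Fin N → T) (G : Fin N → FGraph VC FC (Fin 1))
    (hG : ∀ a, Dgm.mk (G a) = v a) (y : T →₀ k) :
    Finsupp.mapDomain Subtype.val
        (R n P (outerArgs h i (fun a => Finsupp.single (v a) 1) y)) =
      Finsupp.linearCombination k
        (fun d : Dgm VC FC 1 => hatMap P.1 (wick k Adm (outerArgs h i G d.out)))
        (Finsupp.mapDomain Subtype.val y) := by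
  -- Both sides are linear in `y`, so it suffices to let `y` be a basis vector, where the defining
  -- formula of `R` applies.
  have key : (Finsupp.lmapDomain k k (Subtype.val : T → Dgm VC FC 1)) ∘ₗ
      (R n P).toLinearMap (outerArgs h i (fun a => Finsupp.single (v a) 1) 0) i =
      Finsupp.linearCombination k
        (fun d : Dgm VC FC 1 => hatMap P.1 (wick k Adm (outerArgs h i G d.out))) ∘ₗ
      Finsupp.lmapDomain k k Subtype.val := by
    refine Finsupp.lhom_ext' fun t => LinearMap.ext_ring ?_
    simp only [LinearMap.comp_apply, Finsupp.lsingle_apply, MultilinearMap.toLinearMap_apply,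
      Finsupp.lmapDomain_apply, Finsupp.mapDomain_single, Finsupp.linearCombination_single,
      one_smul]
    rw [← outerArgs_eq_update]
    have : outerArgs h i (fun a => Finsupp.single (v a) (1 : k)) (Finsupp.single t 1) =
        fun b => Finsupp.single (outerArgs h i v t b) 1 := by
      funext b
      unfold outerArgs
      rcases (Block.contractEquiv h i).symm b with _ | a <;> rfl
    rw [this]
    refine hR n P _ _ fun b => ?_
    unfold outerArgs
    rcases (Block.contractEquiv h i).symm b with _ | a
    · exact Quotient.out_eq _
    · exact hG a
  have := LinearMap.congr_fun key y
  rw [LinearMap.comp_apply, MultilinearMap.toLinearMap_apply, ← outerArgs_eq_update] at this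
  exact this

/-- Both identities are tested on basis vectors, after the injective passage from the module on `T`
to the module on all one-vertex graphs. -/
theorem isMorphism (hR : IsWickContraction k Adm T R)
    (hS : (contractionOps k VC FC).IsStable (fun n => theorySub k Adm T n)) :
    OperadOps.IsMorphism ((contractionOps k VC FC).restrict _ hS)
      (Q := endOps k (T →₀ k)) R where
  map_act := by
    intro n s Q
    refine MultilinearMap.ext_single (f := R n _) fun v => ?_
    obtain ⟨G, hG⟩ := exists_representatives T v
    apply Finsupp.mapDomain_injective Subtype.val_injective
    refine (hR n _ v G hG).trans ((hatMap_wick_act Adm Q.1 G s).trans ?_)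
    exact (hR n Q (fun a => v (s.symm a)) (fun a => G (s.symm a)) fun a => hG _).symm
  map_comp := by
    intro n j N h i P Q
    refine MultilinearMap.ext_single (f := R N _) fun v => ?_
    obtain ⟨G, hG⟩ := exists_representatives T v
    apply Finsupp.mapDomain_injective Subtype.val_injective
    -- On the left, the Wick sum splits into an inner and an outer one. On the right, the inner
    -- value is a combination of one-vertex graphs, and `apply_outerArgs` substitutes it linearly
    -- into the outer Wick sum.
    refine (hR N _ v G hG).trans ((hatMap_wick_comp h i G Adm j.pos P.1 Q.1).trans ?_)
    refine Eq.trans ?_ (hR.apply_outerArgs h i P v G hG _).symm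
    refine Eq.trans ?_ (congrArg (Finsupp.linearCombination k _) ((hR j Q
      (fun b => v (Block.incl h i b)) (fun b => G (Block.incl h i b)) fun b => hG _).trans
        (hatMap_wick Adm Q.1 _))).symm
    simp only [FGraph.wickSum, map_sum, Finsupp.linearCombination_single]

end IsWickContraction

end Morphism

end

theorem mainTheorem3 {k : Type*} [CommRing k] {VC : Type*} [Fintype VC] {FC : Type*}
    (Adm : Set (FC × FC)) (T : Set (Dgm VC FC 1))
    (hT : ∀ G : FGraph VC FC (Fin 1), Dgm.mk G ∈ T → G.NoTadpole) :
    ∃ hS : (contractionOps k VC FC).IsStable (fun n => theorySub k Adm T n),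
      ((contractionOps k VC FC).restrict _ hS).IsSymmOperad ∧
      (endOps k (T →₀ k)).IsSymmOperad ∧
      ∃ R : ∀ n : ℕ+, theorySub k Adm T n →ₗ[k]
          MultilinearMap k (fun _ : Fin n => T →₀ k) (T →₀ k),
        IsWickContraction k Adm T R ∧
        (∀ R', IsWickContraction k Adm T R' → R' = R) ∧
        OperadOps.IsMorphism ((contractionOps k VC FC).restrict _ hS)
          (Q := endOps k (T →₀ k)) R :=
  have hR := wickMap_isWickContraction (k := k) Adm T
  ⟨theorySub_isStable k Adm T, (contractionOps_isSymmOperad k VC FC).restrict _ _,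
    endOps_isSymmOperad _ k, wickMap k Adm T, hR, fun _ hR' => hR'.eq hR, hR.isMorphism _⟩
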